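/- Let $M$ be a smooth (Hausdorff, second countable, finite-dimensional) manifold, $\varphi:M\to M$ a diffeomorphism, and $\varphi^*:C^\infty(M)\to C^\infty(M)$, $f\mapsto f\circ\varphi$. Sections of $\varphi^!TM$ (the pullback of $TM$ along $\varphi$) are identified with the $(\varphi^*,\varphi^*)$-derivations of $C^\infty(M)$, that is, the linear maps $x$ with $x(fg)=x(f)\varphi^*(g)+\varphi^*(f)x(g)$. A Hom-Lie algebroid $(A,\varphi,\phi_A,[\cdot,\cdot]_A,a_A)$ consists of a smooth real vector bundle $A\to M$, an invertible linear map $\phi_A$ of $\Gamma(A)$ with $\phi_A(fx)=\varphi^*(f)\phi_A(x)$, a skew-symmetric bilinear bracket on $\Gamma(A)$ with $\phi_A[x,y]_A=[\phi_Ax,\phi_Ay]_A$ and $[\phi_Ax,[y,z]_A]_A+[\phi_Ay,[z,x]_A]_A+[\phi_Az,[x,y]_A]_A=0$, and a bundle map $a_A:A\to\varphi^!TM$, such that $[x,fy]_A=\varphi^*(f)[x,y]_A+a_A(\phi_Ax)(f)\,\phi_Ay$, $a_A(\phi_Ax)\circ\varphi^*=\varphi^*\circ a_A(x)$ and $a_A([x,y]_A)\circ\varphi^*=a_A(\phi_Ax)\circ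 a_A(y)-a_A(\phi_Ay)\circ a_A(x)$. The Hom-Schouten bracket is determined by biadditivity and $$[\![x_1\wedge\cdots\wedge x_p,\,y_1\wedge\cdots\wedge y_q]\!]_A=\sum_{i,j}(-1)^{i+j}[x_i,y_j]_A\wedge\phi_A(x_1)\wedge\cdots\widehat{\phi_A(x_i)}\cdots\wedge\phi_A(x_p)\wedge\phi_A(y_1)\wedge\cdots\widehat{\phi_A(y_j)}\cdots\wedge\phi_A(y_q).$$ Let $(\phi_A^\dagger\xi)(x)=\varphi^*\big(\xi(\phi_A^{-1}x)\big)$ for $\xi\in\Gamma(A^*)$, and for $\xi\in\Gamma(A^*)$ put $$(\mathrm d\xi)(x,y)=a_A(x)\big(\xi(\phi_A^{-1}y)\big)-a_A(y)\big(\xi(\phi_A^{-1}x)\big)-(\phi_A^\dagger\xi)\big([\phi_A^{-1}x,\phi_A^{-1}y]_A\big).$$ A Hom-Lie bialgebroid $(A,A^*)$ is a pair of Hom-Lie algebroids $(A,\varphi,\phi_A,[\cdot,\cdot]_A,a_A)$ and $(A^*,\varphi,\phi_A^\dagger,[\cdot,\cdot]_{A^*},a_{A^*})$ with $$\mathrm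 d_*[x,y]_A=[\![\mathrm d_*x,\phi_A(y)]\!]_A+[\![\phi_A(x),\mathrm d_*y]\!]_A\qquad(x,y\in\Gamma(A)),$$ where $\mathrm d_*:\Gamma(A)\to\Gamma(\wedge^2A)$ is the operator $\mathrm d$ of the Hom-Lie algebroid $A^*$. The bundle $\varphi^!TM$ is a Hom-Lie algebroid with $\mathrm{Ad}_{\varphi^*}(x)=\varphi^*\circ x\circ(\varphi^*)^{-1}$, the bracket $[x,y]_{\varphi^*}=\varphi^*\circ x\circ(\varphi^*)^{-1}\circ y\circ(\varphi^*)^{-1}-\varphi^*\circ y\circ(\varphi^*)^{-1}\circ x\circ(\varphi^*)^{-1}$ and the identity as anchor. A bundle map $\pi^\sharp:\varphi^!T^*M\to\varphi^!TM$ defines a Hom-Poisson structure on $M$ if $\pi(\theta,\eta)=\langle\eta,\pi^\sharp(\theta)\rangle$ is a section of $\wedge^2\varphi^!TM$ with $\mathrm{Ad}_{\varphi^*}(\pi)=\pi$ and $[\![\pi,\pi]\!]_{\varphi^!TM}=0$. **Theorem.** Let $(A,A^*)$ be a Hom-Lie bialgebroid over $M$, where the vector bundle $A$ has (constant) rank different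 from $1$. Let $a_A^*:\varphi^!T^*M\to A^*$ and $a_{A^*}^*:\varphi^!T^*M\to A^{**}=A$ be the dual maps of the two anchors. Then $\pi^\sharp=a_A\circ a_{A^*}^*:\varphi^!T^*M\to\varphi^!TM$ defines a Hom-Poisson structure on $M$, and so does $\bar\pi^\sharp=a_{A^*}\circ a_A^*:\varphi^!T^*M\to\varphi^!TM$. Moreover $\pi^\sharp=-\bar\pi^\sharp$. -/

import Mathlib

open scoped Manifold ContDiff

noncomputable section

namespace HomLie

section Algebra

set_option linter.unusedSectionVars false

variable {R : Type*} [CommRing R] [Algebra ℝ R] (σ : R ≃ₐ[ℝ] R)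

/-- The `(σ, σ)`-derivations of `R`, an `R`-module.  For `R = C^∞(M)` and `σ = φ^*` this is
`Γ(φ^! TM)`, the section `x` being identified with the operator
`f ↦ (m ↦ d_{φ(m)} f (x_m))`. -/
structure TwistedDer extends R →ₗ[ℝ] R where
  leibniz' : ∀ f g : R, toFun (f * g) = toFun f * σ g + σ f * toFun g

namespace TwistedDer

variable {σ}

instance : FunLike (TwistedDer σ) R R where
  coe D := D.toLinearMap
  coe_injective := by
    rintro ⟨D, _⟩ ⟨D', _⟩ h
    congr
    exact DFunLike.coe_injective h

instance : LinearMapClass (TwistedDer σ) ℝ R R where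
  map_add D := D.toLinearMap.map_add
  map_smulₛₗ D := D.toLinearMap.map_smul

@[ext] theorem ext {D D' : TwistedDer σ} (h : ∀ f, D f = D' f) : D = D' := DFunLike.ext _ _ h

@[simp] theorem toLinearMap_apply (D : TwistedDer σ) (f : R) : D.toLinearMap f = D f := rfl

theorem mul (D : TwistedDer σ) (f g : R) : D (f * g) = D f * σ g + σ f * D g := D.leibniz' f g

instance : Zero (TwistedDer σ) := ⟨⟨0, by simp⟩⟩

instance : Add (TwistedDer σ) := ⟨fun D D' => ⟨D.toLinearMap + D'.toLinearMap, by
  intro f g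
  simp [mul]
  ring⟩⟩

instance : Neg (TwistedDer σ) := ⟨fun D => ⟨-D.toLinearMap, by
  intro f g
  simp [mul]
  ring⟩⟩

instance : Sub (TwistedDer σ) := ⟨fun D D' => ⟨D.toLinearMap - D'.toLinearMap, by
  intro f g
  simp [mul]
  ring⟩⟩

instance : SMul R (TwistedDer σ) := ⟨fun c D => ⟨c • D.toLinearMap, by
  intro f g
  simp [mul]
  ring⟩⟩

instance : SMul ℝ (TwistedDer σ) := ⟨fun c D => ⟨c • D.toLinearMap, by
  intro f g
  simp [mul]⟩⟩

@[simp] theorem zero_apply (f : R) : (0 : TwistedDer σ) f = 0 := rfl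
@[simp] theorem add_apply (D D' : TwistedDer σ) (f : R) : (D + D') f = D f + D' f := rfl
@[simp] theorem neg_apply (D : TwistedDer σ) (f : R) : (-D) f = -D f := rfl
@[simp] theorem sub_apply (D D' : TwistedDer σ) (f : R) : (D - D') f = D f - D' f := rfl
@[simp] theorem smul_apply (c : R) (D : TwistedDer σ) (f : R) : (c • D) f = c * D f := rfl
@[simp] theorem real_smul_apply (c : ℝ) (D : TwistedDer σ) (f : R) : (c • D) f = c • D f := rfl

instance : AddCommGroup (TwistedDer σ) where
  add_assoc D D' D'' := by ext f; simp [add_assoc]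
  zero_add D := by ext f; simp
  add_zero D := by ext f; simp
  add_comm D D' := by ext f; simp [add_comm]
  neg_add_cancel D := by ext f; simp
  sub_eq_add_neg D D' := by ext f; simp [sub_eq_add_neg]
  nsmul := nsmulRec
  zsmul := zsmulRec

instance : Module R (TwistedDer σ) where
  one_smul D := by ext f; simp
  mul_smul c c' D := by ext f; simp [mul_assoc]
  smul_zero c := by ext f; simp
  smul_add c D D' := by ext f; simp [mul_add]
  add_smul c c' D := by ext f; simp [add_mul]
  zero_smul D := by ext f; simp

instance : Module ℝ (TwistedDer σ) where
  one_smul D := by ext f; simp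
  mul_smul c c' D := by ext f; simp [mul_smul]
  smul_zero c := by ext f; simp
  smul_add c D D' := by ext f; simp
  add_smul c c' D := by ext f; simp [add_smul]
  zero_smul D := by ext f; simp

instance : IsScalarTower ℝ R (TwistedDer σ) where
  smul_assoc c f D := by ext g; simp

/-- A twisted derivation as an operator on `R`. -/
def toOperator : TwistedDer σ →ₗ[ℝ] R →ₗ[ℝ] R where
  toFun D := D.toLinearMap
  map_add' _ _ := rfl
  map_smul' _ _ := rfl

@[simp] theorem toOperator_apply (D : TwistedDer σ) (f : R) : toOperator D f = D f := rfl

end TwistedDer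

/-- `(g, [·,·], φ)` is a Hom-Lie algebra. -/
structure IsHomLieAlgebra {g : Type*} [AddCommGroup g] [Module ℝ g]
    (br : g →ₗ[ℝ] g →ₗ[ℝ] g) (φ : g →ₗ[ℝ] g) : Prop where
  skew : ∀ x y, br x y = - br y x
  map_br : ∀ x y, φ (br x y) = br (φ x) (φ y)
  jacobi : ∀ x y z, br (φ x) (br y z) + br (φ y) (br z x) + br (φ z) (br x y) = 0

/-- `ρ` is a representation of the Hom-Lie algebra `(g, br, φ)` on `V` with respect to `β`. -/
structure IsHomLieRep {g V : Type*} [AddCommGroup g] [Module ℝ g] [AddCommGroup V] [Module ℝ V]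
    (br : g →ₗ[ℝ] g →ₗ[ℝ] g) (φ : g →ₗ[ℝ] g) (β : V →ₗ[ℝ] V)
    (ρ : g →ₗ[ℝ] V →ₗ[ℝ] V) : Prop where
  twist : ∀ x, ρ (φ x) ∘ₗ β = β ∘ₗ ρ x
  bracket : ∀ x y, ρ (br x y) ∘ₗ β = ρ (φ x) ∘ₗ ρ y - ρ (φ y) ∘ₗ ρ x

variable (Γ : Type*) [AddCommGroup Γ] [Module ℝ Γ] [Module R Γ] [IsScalarTower ℝ R Γ]

/-- An invertible Hom-bundle structure on the bundle with `R`-module of sections `Γ`: an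
invertible `φ^*`-function linear map of the sections (`σ = φ^*`). -/
structure InvHomBundle where
  twist : Γ ≃ₗ[ℝ] Γ
  twist_smul : ∀ (f : R) (x : Γ), twist (f • x) = σ f • twist x

/-- A Hom-Lie algebroid (on an invertible Hom-bundle) over the manifold with function ring `R`
and diffeomorphism `φ` (`σ = φ^*`), with module of sections `Γ`.  A bundle map `A → φ^! TM` is an
`R`-linear map from sections of `A` to sections of `φ^! TM`. -/
structure HomLieAlgebroid extends InvHomBundle σ Γ where
  bracket : Γ →ₗ[ℝ] Γ →ₗ[ℝ] Γ
  isHomLieAlgebra : IsHomLieAlgebra bracket twist.toLinearMap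
  anchor : Γ →ₗ[R] TwistedDer σ
  leibniz : ∀ (x y : Γ) (f : R),
    bracket x (f • y) = σ f • bracket x y + anchor (twist x) f • twist y
  anchor_rep : IsHomLieRep bracket twist.toLinearMap σ.toLinearMap
    (TwistedDer.toOperator ∘ₗ anchor.restrictScalars ℝ)

variable {σ Γ}

namespace InvHomBundle

variable (H : InvHomBundle σ Γ)

theorem twist_symm_smul (f : R) (x : Γ) :
    H.twist.symm (f • x) = σ.symm f • H.twist.symm x := by
  rw [LinearEquiv.symm_apply_eq, H.twist_smul]
  simp

/-- The map `φ_A^†` on `Γ(A^*)`: `(φ_A^† ξ)(x) = φ^*(ξ(φ_A⁻¹ x))`.  The sections of the dual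
bundle are the `R`-linear maps `Γ(A) → R`. -/
def dualTwist : Module.Dual R Γ ≃ₗ[ℝ] Module.Dual R Γ where
  toFun ξ :=
    { toFun := fun x => σ (ξ (H.twist.symm x))
      map_add' := by intro x y; simp
      map_smul' := by intro f x; simp [H.twist_symm_smul] }
  invFun ξ :=
    { toFun := fun x => σ.symm (ξ (H.twist x))
      map_add' := by intro x y; simp
      map_smul' := by intro f x; simp [H.twist_smul] }
  map_add' := by intro ξ η; ext x; simp
  map_smul' := by intro c ξ; ext x; simp
  left_inv := by intro ξ; ext x; simp
  right_inv := by intro ξ; ext x; simp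

@[simp] theorem dualTwist_apply (ξ : Module.Dual R Γ) (x : Γ) :
    H.dualTwist ξ x = σ (ξ (H.twist.symm x)) := rfl

@[simp] theorem dualTwist_symm_apply (ξ : Module.Dual R Γ) (x : Γ) :
    H.dualTwist.symm ξ x = σ.symm (ξ (H.twist x)) := rfl

end InvHomBundle

/-- `x ∧ y ∈ Γ(∧²A)`.  Sections of `∧²A` are the alternating `R`-bilinear forms on `Γ(A^*)`. -/
def wedge (x y : Γ) : Module.Dual R Γ →ₗ[R] Module.Dual R Γ →ₗ[R] R :=
  LinearMap.mk₂ R (fun ξ η => ξ x * η y - ξ y * η x)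
    (by intros; simp; ring) (by intros; simp; ring) (by intros; simp; ring)
    (by intros; simp; ring)

@[simp] theorem wedge_apply (x y : Γ) (ξ η : Module.Dual R Γ) :
    wedge x y ξ η = ξ x * η y - ξ y * η x := rfl

/-- The value `(x ∧ y ∧ z)(ξ₁, ξ₂, ξ₃)`. -/
def wedge3 (x y z : Γ) (ξ₁ ξ₂ ξ₃ : Module.Dual R Γ) : R :=
  ξ₁ x * wedge y z ξ₂ ξ₃ + ξ₂ x * wedge y z ξ₃ ξ₁ + ξ₃ x * wedge y z ξ₁ ξ₂

/-- The extension of a bilinear form `B` on `Γ(A)` to `Γ(A^**)`, on which `B(x, y)` is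
`bidualEval B x̂ ŷ` for the evaluations `x̂`, `ŷ` at sections `x`, `y` of `A`. -/
def bidualEval (B : Γ →ₗ[R] Γ →ₗ[R] R) (Λ Λ' : Module.Dual R (Module.Dual R Γ)) : R :=
  Λ (Λ' ∘ₗ B)

namespace HomLieAlgebroid

variable (H : HomLieAlgebroid σ Γ)

theorem bracket_skew (x y : Γ) : H.bracket x y = - H.bracket y x := H.isHomLieAlgebra.skew x y

theorem twist_bracket (x y : Γ) :
    H.twist (H.bracket x y) = H.bracket (H.twist x) (H.twist y) := H.isHomLieAlgebra.map_br x y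

theorem twist_symm_bracket (x y : Γ) :
    H.twist.symm (H.bracket x y) = H.bracket (H.twist.symm x) (H.twist.symm y) := by
  rw [LinearEquiv.symm_apply_eq, H.twist_bracket]
  simp

theorem anchor_twist (x : Γ) (f : R) :
    H.anchor (H.twist x) (σ f) = σ (H.anchor x f) :=
  LinearMap.congr_fun (H.anchor_rep.twist x) f

theorem smul_leibniz (x y : Γ) (f : R) :
    H.bracket (f • x) y = σ f • H.bracket x y - H.anchor (H.twist y) f • H.twist x := by
  rw [H.bracket_skew, H.leibniz, H.bracket_skew y x]
  simp only [smul_neg, neg_add_rev, neg_neg]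
  abel

/-- The differential on functions, `⟨df, x⟩ = a_A(x)(f)`. -/
def d0 (f : R) : Module.Dual R Γ where
  toFun x := H.anchor x f
  map_add' := by intro x y; simp
  map_smul' := by intro c x; simp

@[simp] theorem d0_apply (f : R) (x : Γ) : H.d0 f x = H.anchor x f := rfl

/-- The differential on `Γ(A^*)`:
`(dξ)(x, y) = a_A(x)(ξ(φ_A⁻¹ y)) - a_A(y)(ξ(φ_A⁻¹ x)) - (φ_A^† ξ)([φ_A⁻¹ x, φ_A⁻¹ y])`. -/
def d1 (ξ : Module.Dual R Γ) : Γ →ₗ[R] Γ →ₗ[R] R :=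
  LinearMap.mk₂ R
    (fun x y => H.anchor x (ξ (H.twist.symm y)) - H.anchor y (ξ (H.twist.symm x))
      - H.dualTwist ξ (H.bracket (H.twist.symm x) (H.twist.symm y)))
    (by intros; simp; ring)
    (by
      intro c x y
      simp [H.twist_symm_smul, H.twist_symm_bracket, H.smul_leibniz, TwistedDer.mul]
      ring)
    (by intros; simp; ring)
    (by
      intro c x y
      simp [H.twist_symm_smul, H.leibniz, TwistedDer.mul]
      ring)

theorem d1_apply (ξ : Module.Dual R Γ) (x y : Γ) :
    H.d1 ξ x y = H.anchor x (ξ (H.twist.symm y)) - H.anchor y (ξ (H.twist.symm x))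
      - H.dualTwist ξ (H.bracket (H.twist.symm x) (H.twist.symm y)) := rfl

/-- The extension of `φ_A` to `Γ(∧²A)`, `φ_A (x ∧ y) = φ_A x ∧ φ_A y`. -/
def twist2 (X : Module.Dual R Γ →ₗ[R] Module.Dual R Γ →ₗ[R] R) :
    Module.Dual R Γ →ₗ[R] Module.Dual R Γ →ₗ[R] R :=
  LinearMap.mk₂ R (fun ξ η => σ (X (H.dualTwist.symm ξ) (H.dualTwist.symm η)))
    (by intros; simp)
    (by
      intro c ξ η
      have : H.dualTwist.symm (c • ξ) = σ.symm c • H.dualTwist.symm ξ := by ext x; simp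
      simp [this])
    (by intros; simp)
    (by
      intro c ξ η
      have : H.dualTwist.symm (c • η) = σ.symm c • H.dualTwist.symm η := by ext x; simp
      simp [this])

@[simp] theorem twist2_apply (X : Module.Dual R Γ →ₗ[R] Module.Dual R Γ →ₗ[R] R)
    (ξ η : Module.Dual R Γ) :
    H.twist2 X ξ η = σ (X (H.dualTwist.symm ξ) (H.dualTwist.symm η)) := rfl

theorem twist2_wedge (x y : Γ) : H.twist2 (wedge x y) = wedge (H.twist x) (H.twist y) := by
  ext ξ η
  simp

/-- The Lie derivative of `ξ ∈ Γ(A^*)` along `x ∈ Γ(A)`: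
`⟨L_x ξ, y⟩ = a_A(φ_A x)⟨ξ, φ_A⁻¹ y⟩ - ⟨φ_A^† ξ, [x, φ_A⁻¹ y]⟩`. -/
def lieForm (x : Γ) (ξ : Module.Dual R Γ) : Module.Dual R Γ where
  toFun y := H.anchor (H.twist x) (ξ (H.twist.symm y))
    - H.dualTwist ξ (H.bracket x (H.twist.symm y))
  map_add' := by intro y z; simp; ring
  map_smul' := by
    intro c y
    simp [H.twist_symm_smul, H.twist_symm_bracket, H.leibniz, TwistedDer.mul]
    ring

@[simp] theorem lieForm_apply (x : Γ) (ξ : Module.Dual R Γ) (y : Γ) :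
    H.lieForm x ξ y = H.anchor (H.twist x) (ξ (H.twist.symm y))
      - H.dualTwist ξ (H.bracket x (H.twist.symm y)) := rfl

/-- The value on `ξ, η ∈ Γ(A^*)` of the Hom-Schouten bracket `⟦x, X⟧` of `x ∈ Γ(A)` and
`X ∈ Γ(∧²A)`.  It is the operation with
`⟦x, y ∧ z⟧ = [x, y] ∧ φ_A z - [x, z] ∧ φ_A y`, see `schouten12_wedge`. -/
def schouten12 (x : Γ) (X : Module.Dual R Γ →ₗ[R] Module.Dual R Γ →ₗ[R] R)
    (ξ η : Module.Dual R Γ) : R :=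
  H.anchor (H.twist x) (X (H.dualTwist.symm ξ) (H.dualTwist.symm η))
    - H.twist2 X (H.lieForm x (H.dualTwist.symm ξ)) η
    - H.twist2 X ξ (H.lieForm x (H.dualTwist.symm η))

theorem schouten12_wedge (x y z : Γ) (ξ η : Module.Dual R Γ) :
    H.schouten12 x (wedge y z) ξ η =
      wedge (H.bracket x y) (H.twist z) ξ η - wedge (H.bracket x z) (H.twist y) ξ η := by
  simp only [schouten12, H.twist2_wedge, wedge_apply, map_sub, TwistedDer.mul, lieForm_apply,
    InvHomBundle.dualTwist_symm_apply, AlgEquiv.apply_symm_apply,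
    LinearEquiv.symm_apply_apply, LinearEquiv.apply_symm_apply]
  ring

/-- The value on `ξ, η ∈ Γ(A^*)` of the Hom-Schouten bracket `⟦X, y⟧` of `X ∈ Γ(∧²A)` and
`y ∈ Γ(A)`; by graded skew-symmetry it is `-⟦y, X⟧`.  See `schouten21_wedge`. -/
def schouten21 (X : Module.Dual R Γ →ₗ[R] Module.Dual R Γ →ₗ[R] R) (y : Γ)
    (ξ η : Module.Dual R Γ) : R :=
  - H.schouten12 y X ξ η

theorem schouten21_wedge (x y z : Γ) (ξ η : Module.Dual R Γ) :
    H.schouten21 (wedge x y) z ξ η =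
      wedge (H.bracket x z) (H.twist y) ξ η - wedge (H.bracket y z) (H.twist x) ξ η := by
  rw [schouten21, schouten12_wedge, H.bracket_skew x z, H.bracket_skew y z]
  simp only [wedge_apply, map_neg]
  ring

/-- One of the three cyclic terms in the Hom-Schouten bracket of two bisections. -/
def schouten22Term (X Y : Module.Dual R Γ →ₗ[R] Module.Dual R Γ →ₗ[R] R)
    (η₁ η₂ η₃ : Module.Dual R Γ) : R :=
  X η₁ (H.d0 (σ.symm (Y η₂ η₃))) + Y η₁ (H.d0 (σ.symm (X η₂ η₃)))
    - bidualEval (H.d1 (H.dualTwist.symm η₁)) (X η₂) (Y η₃)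
    + bidualEval (H.d1 (H.dualTwist.symm η₁)) (X η₃) (Y η₂)

/-- The value on `ξ₁, ξ₂, ξ₃ ∈ Γ(A^*)` of the Hom-Schouten bracket `⟦X, Y⟧ ∈ Γ(∧³A)` of two
bisections `X, Y ∈ Γ(∧²A)`.  It is the operation with
`⟦x₁ ∧ x₂, y₁ ∧ y₂⟧ = ∑ i j, (-1)^(i+j) [x_i, y_j] ∧ φ_A x_{i'} ∧ φ_A y_{j'}`
where `{i, i'} = {j, j'} = {1, 2}`, see `schouten22_wedge`. -/
def schouten22 (X Y : Module.Dual R Γ →ₗ[R] Module.Dual R Γ →ₗ[R] R)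
    (ξ₁ ξ₂ ξ₃ : Module.Dual R Γ) : R :=
  σ (H.schouten22Term X Y (H.dualTwist.symm ξ₁) (H.dualTwist.symm ξ₂) (H.dualTwist.symm ξ₃)
    + H.schouten22Term X Y (H.dualTwist.symm ξ₂) (H.dualTwist.symm ξ₃) (H.dualTwist.symm ξ₁)
    + H.schouten22Term X Y (H.dualTwist.symm ξ₃) (H.dualTwist.symm ξ₁) (H.dualTwist.symm ξ₂))

theorem schouten22_wedge (x₁ x₂ y₁ y₂ : Γ) (ξ₁ ξ₂ ξ₃ : Module.Dual R Γ) :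
    H.schouten22 (wedge x₁ x₂) (wedge y₁ y₂) ξ₁ ξ₂ ξ₃ =
      wedge3 (H.bracket x₁ y₁) (H.twist x₂) (H.twist y₂) ξ₁ ξ₂ ξ₃
      - wedge3 (H.bracket x₁ y₂) (H.twist x₂) (H.twist y₁) ξ₁ ξ₂ ξ₃
      - wedge3 (H.bracket x₂ y₁) (H.twist x₁) (H.twist y₂) ξ₁ ξ₂ ξ₃
      + wedge3 (H.bracket x₂ y₂) (H.twist x₁) (H.twist y₁) ξ₁ ξ₂ ξ₃ := by
  have key : ∀ (x y x' y' : Γ) (ζ η η' : Module.Dual R Γ),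
      bidualEval (H.d1 ζ) (wedge x y η) (wedge x' y' η') =
        η x * η' x' * H.d1 ζ y y' - η x * η' y' * H.d1 ζ y x'
          - η y * η' x' * H.d1 ζ x y' + η y * η' y' * H.d1 ζ x x' := by
    intro x y x' y' ζ η η'
    simp only [bidualEval, wedge_apply, LinearMap.comp_apply]
    ring
  have hd : ∀ (x : Γ) (r : R), σ (H.anchor x (σ.symm r)) = H.anchor (H.twist x) r := by
    intro x r
    rw [← H.anchor_twist]
    simp
  simp only [schouten22, schouten22Term, key, wedge3, wedge_apply, d0_apply, d1_apply, map_add,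
    map_sub, map_mul, TwistedDer.mul, hd, H.twist_bracket,
    InvHomBundle.dualTwist_symm_apply, AlgEquiv.apply_symm_apply,
    LinearEquiv.apply_symm_apply]
  ring

/-- The dual `a_A^* : Γ(φ^! T^*M) → Γ(A^*)` of the anchor.  Sections of `φ^! T^*M` are the
`R`-linear maps `Γ(φ^! TM) → R`. -/
def anchorDual : Module.Dual R (TwistedDer σ) →ₗ[R] Module.Dual R Γ := H.anchor.dualMap

end HomLieAlgebroid

/-- For an anchor on `A^*`, its dual `a_{A^*}^* : Γ(φ^! T^*M) → Γ(A)`, under the identification of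
`A^**` with `A`. -/
def HomLieAlgebroid.coanchorDual [Module.IsReflexive R Γ]
    (H' : HomLieAlgebroid σ (Module.Dual R Γ)) :
    Module.Dual R (TwistedDer σ) →ₗ[R] Γ :=
  (Module.evalEquiv R Γ).symm.toLinearMap ∘ₗ H'.anchor.dualMap

/-- `d_* : Γ(A) → Γ(∧²A)`, the differential of the Hom-Lie algebroid `A^*`. -/
def HomLieAlgebroid.codiff (H' : HomLieAlgebroid σ (Module.Dual R Γ)) (x : Γ) :
    Module.Dual R Γ →ₗ[R] Module.Dual R Γ →ₗ[R] R :=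
  H'.d1 (Module.Dual.eval R Γ x)

/-- `(A, A^*)` is a Hom-Lie bialgebroid: the two structures are in duality, that is, the
Hom-bundle structure of `A^*` is `φ_A^†`, and
`d_*[x, y] = ⟦d_* x, φ_A y⟧ + ⟦φ_A x, d_* y⟧` for all `x, y ∈ Γ(A)`. -/
structure IsHomLieBialgebroid (H : HomLieAlgebroid σ Γ)
    (H' : HomLieAlgebroid σ (Module.Dual R Γ)) : Prop where
  dual_twist : H'.twist = H.dualTwist
  compat : ∀ (x y : Γ) (ξ η : Module.Dual R Γ),
    H'.codiff (H.bracket x y) ξ η =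
      H.schouten21 (H'.codiff x) (H.twist y) ξ η + H.schouten12 (H.twist x) (H'.codiff y) ξ η

variable (σ)

/-- `Ad_{φ^*}(x) = φ^* ∘ x ∘ (φ^*)⁻¹` on `Γ(φ^! TM)`. -/
def tangentTwist : TwistedDer σ ≃ₗ[ℝ] TwistedDer σ where
  toFun D := ⟨σ.toLinearMap ∘ₗ D.toLinearMap ∘ₗ σ.symm.toLinearMap, by
    intro f g
    simp [TwistedDer.mul]⟩
  invFun D := ⟨σ.symm.toLinearMap ∘ₗ D.toLinearMap ∘ₗ σ.toLinearMap, by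
    intro f g
    simp [TwistedDer.mul]⟩
  map_add' := by intro D D'; ext f; exact map_add σ _ _
  map_smul' := by intro c D; ext f; exact map_smul σ c _
  left_inv := by
    intro D
    ext f
    change σ.symm (σ (D (σ.symm (σ f)))) = D f
    simp
  right_inv := by
    intro D
    ext f
    change σ (σ.symm (D (σ (σ.symm f)))) = D f
    simp

@[simp] theorem tangentTwist_apply (D : TwistedDer σ) (f : R) :
    tangentTwist σ D f = σ (D (σ.symm f)) := rfl

variable {σ} in
/-- The derivation `φ^* ∘ x ∘ (φ^*)⁻¹ ∘ y ∘ (φ^*)⁻¹ - φ^* ∘ y ∘ (φ^*)⁻¹ ∘ x ∘ (φ^*)⁻¹`. -/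
def TwistedDer.comm (x y : TwistedDer σ) : TwistedDer σ where
  toLinearMap :=
    σ.toLinearMap ∘ₗ x.toLinearMap ∘ₗ σ.symm.toLinearMap ∘ₗ y.toLinearMap ∘ₗ σ.symm.toLinearMap
    - σ.toLinearMap ∘ₗ y.toLinearMap ∘ₗ σ.symm.toLinearMap ∘ₗ x.toLinearMap ∘ₗ σ.symm.toLinearMap
  leibniz' := by
    intro f g
    simp [TwistedDer.mul]
    ring

variable {σ} in
@[simp] theorem TwistedDer.comm_apply (x y : TwistedDer σ) (f : R) :
    x.comm y f = σ (x (σ.symm (y (σ.symm f)))) - σ (y (σ.symm (x (σ.symm f)))) := rfl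

/-- The bracket
`[x, y]_{φ^*} = φ^* ∘ x ∘ (φ^*)⁻¹ ∘ y ∘ (φ^*)⁻¹ - φ^* ∘ y ∘ (φ^*)⁻¹ ∘ x ∘ (φ^*)⁻¹`
on `Γ(φ^! TM)`. -/
def tangentBracket : TwistedDer σ →ₗ[ℝ] TwistedDer σ →ₗ[ℝ] TwistedDer σ :=
  LinearMap.mk₂ ℝ TwistedDer.comm
    (by intro x x' y; ext f; simp; ring)
    (by intro c x y; ext f; simp [smul_sub])
    (by intro x y y'; ext f; simp; ring)
    (by intro c x y; ext f; simp [smul_sub])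

@[simp] theorem tangentBracket_apply (x y : TwistedDer σ) (f : R) :
    tangentBracket σ x y f =
      σ (x (σ.symm (y (σ.symm f)))) - σ (y (σ.symm (x (σ.symm f)))) := rfl

/-- The tangent Hom-Lie algebroid `(φ^! TM, φ, Ad_{φ^*}, [·,·]_{φ^*}, id)`. -/
def tangent : HomLieAlgebroid σ (TwistedDer σ) where
  twist := tangentTwist σ
  twist_smul := by intro f D; ext g; simp
  bracket := tangentBracket σ
  isHomLieAlgebra :=
    { skew := by intro x y; ext f; simp
      map_br := by intro x y; ext f; simp
      jacobi := by intro x y z; ext f; simp; ring }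
  anchor := LinearMap.id
  leibniz := by
    intro x y f
    ext g
    simp [TwistedDer.mul]
    ring
  anchor_rep :=
    { twist := by intro x; ext f; simp
      bracket := by intro x y; ext f; simp }

variable {σ}

/-- `π ∈ Γ(∧² φ^! TM)` is a Hom-Poisson tensor: an alternating bilinear form on `Γ(φ^! T^*M)` with
`Ad_{φ^*}(π) = π` and `⟦π, π⟧ = 0`. -/
structure IsHomPoissonTensor
    (π : Module.Dual R (TwistedDer σ) →ₗ[R] Module.Dual R (TwistedDer σ) →ₗ[R] R) : Prop where
  alt : ∀ θ, π θ θ = 0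
  twist : (tangent σ).twist2 π = π
  schouten : ∀ θ₁ θ₂ θ₃, (tangent σ).schouten22 π π θ₁ θ₂ θ₃ = 0

/-- A bundle map `P : φ^! T^*M → φ^! TM` defines a Hom-Poisson structure: `P = π^♯` for a
Hom-Poisson tensor `π`, i.e. the bilinear form `π(θ, η) = ⟨η, P θ⟩` is a Hom-Poisson tensor. -/
def DefinesHomPoisson (P : Module.Dual R (TwistedDer σ) →ₗ[R] TwistedDer σ) : Prop :=
  IsHomPoissonTensor (Module.Dual.eval R (TwistedDer σ) ∘ₗ P)

/-- `π^♯ = a_A ∘ a_{A^*}^* : φ^! T^*M → φ^! TM`. -/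
def piSharp [Module.IsReflexive R Γ] (H : HomLieAlgebroid σ Γ)
    (H' : HomLieAlgebroid σ (Module.Dual R Γ)) :
    Module.Dual R (TwistedDer σ) →ₗ[R] TwistedDer σ :=
  H.anchor ∘ₗ H'.coanchorDual

/-- `π̄^♯ = a_{A^*} ∘ a_A^* : φ^! T^*M → φ^! TM`. -/
def piBarSharp (H : HomLieAlgebroid σ Γ) (H' : HomLieAlgebroid σ (Module.Dual R Γ)) :
    Module.Dual R (TwistedDer σ) →ₗ[R] TwistedDer σ :=
  H'.anchor ∘ₗ H.anchorDual

end Algebra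

section Manifold

open Bundle

variable {E : Type*} [NormedAddCommGroup E] [NormedSpace ℝ E]
  {H : Type*} [TopologicalSpace H] {I : ModelWithCorners ℝ E H}
  {M : Type*} [TopologicalSpace M] [ChartedSpace H M]

/-- The automorphism `φ^* : f ↦ f ∘ φ` of `C^∞(M)`. -/
def pullback (φ : M ≃ₘ⟮I, I⟯ M) : C^∞⟮I, M; 𝓘(ℝ, ℝ), ℝ⟯ ≃ₐ[ℝ] C^∞⟮I, M; 𝓘(ℝ, ℝ), ℝ⟯ where
  toFun f := ⟨fun m => f (φ m), f.contMDiff.comp φ.contMDiff⟩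
  invFun f := ⟨fun m => f (φ.symm m), f.contMDiff.comp φ.symm.contMDiff⟩
  left_inv := by intro f; ext m; simp
  right_inv := by intro f; ext m; simp
  map_mul' := by intro f g; rfl
  map_add' := by intro f g; rfl
  commutes' := by intro c; rfl

@[simp] theorem pullback_apply (φ : M ≃ₘ⟮I, I⟯ M) (f : C^∞⟮I, M; 𝓘(ℝ, ℝ), ℝ⟯) (m : M) :
    pullback φ f m = f (φ m) := rfl

variable {F : Type*} [NormedAddCommGroup F] [NormedSpace ℝ F]
  {A : M → Type*} [TopologicalSpace (TotalSpace F A)]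
  [∀ m, AddCommGroup (A m)] [∀ m, Module ℝ (A m)] [∀ m, TopologicalSpace (A m)]
  [FiberBundle F A] [VectorBundle ℝ F A]

/-- Smooth sections form a module over the smooth functions, with the pointwise product. -/
instance sectionModule : Module C^∞⟮I, M; 𝓘(ℝ, ℝ), ℝ⟯ Cₛ^∞⟮I; F, A⟯ where
  smul f s := ⟨fun m => f m • s m, f.contMDiff.smul_section s.contMDiff⟩
  one_smul s := by ext m; exact one_smul ℝ (s m)
  mul_smul f g s := by ext m; exact mul_smul (f m) (g m) (s m)
  smul_zero f := by ext m; exact smul_zero (f m)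
  smul_add f s t := by ext m; exact smul_add (f m) (s m) (t m)
  add_smul f g s := by ext m; exact add_smul (f m) (g m) (s m)
  zero_smul s := by ext m; exact zero_smul ℝ (s m)

@[simp] theorem section_smul_apply (f : C^∞⟮I, M; 𝓘(ℝ, ℝ), ℝ⟯) (s : Cₛ^∞⟮I; F, A⟯) (m : M) :
    (f • s) m = f m • s m := rfl

instance sectionScalarTower :
    IsScalarTower ℝ C^∞⟮I, M; 𝓘(ℝ, ℝ), ℝ⟯ Cₛ^∞⟮I; F, A⟯ where
  smul_assoc c f s := by ext m; exact smul_assoc c (f m) (s m)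

variable [FiniteDimensional ℝ E] [T2Space M] [IsManifold I ∞ M]
  [FiniteDimensional ℝ F] [ContMDiffVectorBundle ∞ F A I]

/-- Near each point there are global sections `s i` of `A` and of `A^*` (given as linear maps
`ξ i` on sections) which, up to the square of a cut-off function `χ`, form a dual pair of frames. -/
theorem exists_cutoff_frame (m₀ : M) :
    ∃ (n : ℕ) (χ : C^∞⟮I, M; 𝓘(ℝ, ℝ), ℝ⟯) (s : Fin n → Cₛ^∞⟮I; F, A⟯)
      (ξ : Fin n → Module.Dual C^∞⟮I, M; 𝓘(ℝ, ℝ), ℝ⟯ Cₛ^∞⟮I; F, A⟯),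
      (∀ᶠ m in nhds m₀, χ m = 1) ∧
      (∀ x : Cₛ^∞⟮I; F, A⟯, (χ * χ) • x = ∑ i, ξ i x • s i) ∧
      (∀ x y : Cₛ^∞⟮I; F, A⟯, ∀ m, x m = y m → ∀ i, ξ i x m = ξ i y m) := by
  classical
  have : ContMDiffVectorBundle 1 F A I := ContMDiffVectorBundle.of_le (n := ∞) (by simp)
  set e := trivializationAt F A m₀ with he
  have hm₀ : m₀ ∈ e.baseSet := FiberBundle.mem_baseSet_trivializationAt F A m₀
  let b := Module.finBasis ℝ F
  obtain ⟨χ, -, hχ⟩ := (SmoothBumpFunction.nhds_basis_tsupport (I := I) (c := m₀)).mem_iff.1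
    (e.open_baseSet.mem_nhds hm₀)
  have hsm : ∀ i, ContMDiff I (I.prod 𝓘(ℝ, F)) ∞
      (fun m => TotalSpace.mk' F m ((χ : M → ℝ) m • e.localFrame b i m)) := fun i =>
    ContMDiffOn.smul_section_of_tsupport (u := e.baseSet) (s := e.localFrame b i)
      χ.contMDiff.contMDiffOn e.open_baseSet hχ
      (e.contMDiffOn_localFrame_baseSet ∞ b i)
  have hξ : ∀ (x : Cₛ^∞⟮I; F, A⟯) i, ContMDiff I 𝓘(ℝ, ℝ) ∞
      (fun m => (χ : M → ℝ) m • e.localFrameCoeff I b i m (x m)) := by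
    intro x i
    apply contMDiff_of_tsupport
    intro m hm
    have hm' : m ∈ e.baseSet := hχ ((tsupport_smul_subset_left _ _) hm)
    exact (χ.contMDiffAt).smul
      (contMDiffAt_localFrameCoeff b hm' (x.contMDiff m) i)
  refine ⟨_, ⟨χ, χ.contMDiff⟩, fun i => ⟨fun m => (χ : M → ℝ) m • e.localFrame b i m, hsm i⟩,
    fun i =>
      { toFun := fun x => ⟨fun m => (χ : M → ℝ) m • e.localFrameCoeff I b i m (x m), hξ x i⟩
        map_add' := ?_
        map_smul' := ?_ }, ?_, ?_, ?_⟩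
  · intro x y
    ext m
    change (χ : M → ℝ) m • e.localFrameCoeff I b i m (x m + y m) =
      (χ : M → ℝ) m • e.localFrameCoeff I b i m (x m)
        + (χ : M → ℝ) m • e.localFrameCoeff I b i m (y m)
    rw [map_add, smul_add]
  · intro f x
    ext m
    change (χ : M → ℝ) m • e.localFrameCoeff I b i m (f m • x m) =
      f m * ((χ : M → ℝ) m • e.localFrameCoeff I b i m (x m))
    rw [map_smul, smul_eq_mul, smul_eq_mul, smul_eq_mul]
    ring
  · exact χ.eventuallyEq_one
  · intro x
    have hsum : ∀ (t : Fin (Module.finrank ℝ F) → Cₛ^∞⟮I; F, A⟯) (m : M),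
        (∑ i, t i) m = ∑ i, t i m := by
      intro t m
      have := congrFun (map_sum (ContMDiffSection.coeAddHom I F ∞ A) t Finset.univ) m
      rw [Finset.sum_apply] at this
      exact this
    ext m
    rw [hsum]
    by_cases hm : m ∈ e.baseSet
    · have := e.eq_sum_localFrameCoeff_smul (I := I) (b := b) (s := fun m => x m) hm
      change ((χ : M → ℝ) m * (χ : M → ℝ) m) • x m = ∑ i,
        ((χ : M → ℝ) m • e.localFrameCoeff I b i m (x m)) • ((χ : M → ℝ) m • e.localFrame b i m)
      conv_lhs => rw [this]
      rw [Finset.smul_sum]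
      refine Finset.sum_congr rfl fun i _ => ?_
      simp only [smul_smul, smul_eq_mul]
      congr 1
      ring
    · have h0 : (χ : M → ℝ) m = 0 := image_eq_zero_of_notMem_tsupport fun h => hm (hχ h)
      change ((χ : M → ℝ) m * (χ : M → ℝ) m) • x m = ∑ i,
        ((χ : M → ℝ) m • e.localFrameCoeff I b i m (x m)) • ((χ : M → ℝ) m • e.localFrame b i m)
      simp [h0]
  · intro x y m hxy i
    change (χ : M → ℝ) m • e.localFrameCoeff I b i m (x m) =
      (χ : M → ℝ) m • e.localFrameCoeff I b i m (y m)
    rw [hxy]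

/-- The value of `ζ x` at `m` depends only on `x m`. -/
theorem dual_apply_congr (ζ : Module.Dual C^∞⟮I, M; 𝓘(ℝ, ℝ), ℝ⟯ Cₛ^∞⟮I; F, A⟯)
    {x y : Cₛ^∞⟮I; F, A⟯} {m : M} (h : x m = y m) : ζ x m = ζ y m := by
  obtain ⟨n, χ, s, ξ, hχ, hs, hξ⟩ := exists_cutoff_frame (I := I) (F := F) (A := A) m
  have key : ∀ z : Cₛ^∞⟮I; F, A⟯, ζ z m = ∑ i, ξ i z m * ζ (s i) m := by
    intro z
    have h1 := congrArg (fun g : C^∞⟮I, M; 𝓘(ℝ, ℝ), ℝ⟯ => ContMDiffMap.evalRingHom m g)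
      (congrArg ζ (hs z))
    simp only [map_smul, map_sum, smul_eq_mul, map_mul] at h1
    have h2 : ContMDiffMap.evalRingHom m χ = 1 := hχ.self_of_nhds
    rw [h2, one_mul, one_mul] at h1
    exact h1
  rw [key, key]
  exact Finset.sum_congr rfl fun i _ => by rw [hξ x y m h i]

/-- Sections of `A^*` separate the values of sections of `A`. -/
theorem eq_of_dual_apply_eq {x y : Cₛ^∞⟮I; F, A⟯} {m : M}
    (h : ∀ ζ : Module.Dual C^∞⟮I, M; 𝓘(ℝ, ℝ), ℝ⟯ Cₛ^∞⟮I; F, A⟯, ζ x m = ζ y m) : x m = y m := by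
  obtain ⟨n, χ, s, ξ, hχ, hs, hξ⟩ := exists_cutoff_frame (I := I) (F := F) (A := A) m
  have hsum : ∀ (t : Fin n → Cₛ^∞⟮I; F, A⟯), (∑ i, t i) m = ∑ i, t i m := by
    intro t
    have := congrFun (map_sum (ContMDiffSection.coeAddHom I F ∞ A) t Finset.univ) m
    rw [Finset.sum_apply] at this
    exact this
  have key : ∀ z : Cₛ^∞⟮I; F, A⟯, z m = ∑ i, ξ i z m • s i m := by
    intro z
    have h1 : ((χ * χ) • z) m = (∑ i, ξ i z • s i) m := by rw [hs z]
    rw [hsum] at h1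
    have h2 : χ m = 1 := hχ.self_of_nhds
    have h3 : ((χ * χ) • z) m = (χ m * χ m) • z m := rfl
    rw [h3, h2, one_mul, one_smul] at h1
    exact h1
  rw [key x, key y]
  exact Finset.sum_congr rfl fun i _ => by rw [h (ξ i)]

/-- `A^** = A` on the level of sections. -/
instance section_isReflexive :
    Module.IsReflexive C^∞⟮I, M; 𝓘(ℝ, ℝ), ℝ⟯ Cₛ^∞⟮I; F, A⟯ where
  bijective_dual_eval' := by
    constructor
    · intro x y hxy
      ext m
      apply eq_of_dual_apply_eq (I := I) (F := F)
      intro ζ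
      have := LinearMap.congr_fun hxy ζ
      simp only [Module.Dual.eval_apply] at this
      rw [this]
    · intro Λ
      choose n χ s ξ hχ hs hξ using exists_cutoff_frame (I := I) (F := F) (A := A)
      let y : M → Cₛ^∞⟮I; F, A⟯ := fun m₀ => ∑ i, Λ (ξ m₀ i) • s m₀ i
      have hy : ∀ m₀ m, χ m₀ m = 1 → ∀ ζ, ζ (y m₀) m = Λ ζ m := by
        intro m₀ m hm ζ
        have h1 : (χ m₀ * χ m₀) • ζ = ∑ i, ζ (s m₀ i) • ξ m₀ i := by
          ext1 x
          have := congrArg ζ (hs m₀ x)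
          simp only [map_smul, map_sum, smul_eq_mul] at this
          simp only [LinearMap.smul_apply, LinearMap.sum_apply, smul_eq_mul]
          rw [this]
          exact Finset.sum_congr rfl fun i _ => mul_comm _ _
        have h2 : (χ m₀ * χ m₀) * Λ ζ = ζ (y m₀) := by
          have := congrArg Λ h1
          simp only [map_smul, map_sum, smul_eq_mul] at this
          simp only [y, map_smul, map_sum, smul_eq_mul]
          rw [this]
          exact Finset.sum_congr rfl fun i _ => mul_comm _ _
        rw [← h2]
        change (χ m₀ m * χ m₀ m) * Λ ζ m = Λ ζ m
        rw [hm, one_mul, one_mul]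
      have hloc : ∀ m₀ m, χ m₀ m = 1 → y m m = y m₀ m := by
        intro m₀ m hm
        apply eq_of_dual_apply_eq (I := I) (F := F)
        intro ζ
        rw [hy m m (hχ m).self_of_nhds, hy m₀ m hm]
      refine ⟨⟨fun m => y m m, ?_⟩, ?_⟩
      · intro m₀
        refine ((y m₀).contMDiff m₀).congr_of_eventuallyEq ?_
        filter_upwards [hχ m₀] with m hm
        exact congrArg (TotalSpace.mk' F m) (hloc m₀ m hm)
      · ext ζ m
        rw [Module.Dual.eval_apply, ← hy m m (hχ m).self_of_nhds ζ]
        exact dual_apply_congr ζ rfl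

end Manifold
end HomLie

end

/-! The twist can be removed. If `x` is a `(φ^*, φ^*)`-derivation, then `x ∘ (φ^*)⁻¹` is an ordinary
derivation (`TwistedDer.act`), and `φ_A⁻¹ [x, y]` (`lieBr`) is an ordinary Lie algebroid bracket for
which `φ_A` is an automorphism. In these terms a Hom-Lie bialgebroid is an ordinary Lie bialgebroid
with compatible automorphisms (`cobr_lieBr`), and the classical argument for Lie bialgebroids
applies.

Comparing the compatibility condition for `(x, f y)` with `f` times that for `(x, y)` leaves
`(L_{df} x - [x, d_* f]) ∧ y = 0` for all `y`. As the rank is not 1, this forces `L_{df} x = [x, d_*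
f]` (`lieDeriv_diff`). Replacing `x` by `g x` gives `a_{A^*}(df) = -a_A(d_* f)` (`anchor_diff_add`),
which is both `π^♯ = -π̄^♯` and the skew-symmetry of `{f, g} = a_A(d_* f) g`. Taking `x = d_* g`
gives `d_* {f, g} = [d_* f, d_* g]` (`codiff0_poisson`), hence the Jacobi identity.

For a skew-symmetric `P`, the Schouten bracket of its tensor with itself is, up to the twist, twice
a Jacobiator that is linear over functions in each slot (`schouten22_eq_jacobiator`). It is
therefore enough to test on exact forms, since every form is locally a combination of these
(`locallyExact`). The latter rests on Hadamard's lemma in a chart. -/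

noncomputable section

namespace HomLie

/-! ### Untwisting: the ordinary derivations and Lie algebroid behind the Hom-structures. -/

section Untwist

set_option linter.unusedSectionVars false

variable {R : Type*} [CommRing R] [Algebra ℝ R] {σ : R ≃ₐ[ℝ] R}

namespace TwistedDer

/-- The ordinary derivation `x ∘ (φ^*)⁻¹` attached to a twisted derivation `x`. -/
def act (D : TwistedDer σ) (f : R) : R := D (σ.symm f)

theorem act_def (D : TwistedDer σ) (f : R) : D.act f = D (σ.symm f) := rfl

@[simp] theorem act_add (D : TwistedDer σ) (f g : R) : D.act (f + g) = D.act f + D.act g := by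
  simp [act]

@[simp] theorem act_sub (D : TwistedDer σ) (f g : R) : D.act (f - g) = D.act f - D.act g := by
  simp [act]

@[simp] theorem act_neg (D : TwistedDer σ) (f : R) : D.act (-f) = -D.act f := by
  simp [act]

@[simp] theorem act_mul (D : TwistedDer σ) (f g : R) :
    D.act (f * g) = D.act f * g + f * D.act g := by
  simp [act, mul]

@[simp] theorem add_act (D D' : TwistedDer σ) (f : R) : (D + D').act f = D.act f + D'.act f := rfl
@[simp] theorem neg_act (D : TwistedDer σ) (f : R) : (-D).act f = -D.act f := rfl
@[simp] theorem smul_act (c : R) (D : TwistedDer σ) (f : R) : (c • D).act f = c * D.act f := rfl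

theorem ext_act {D D' : TwistedDer σ} (h : ∀ f, D.act f = D'.act f) : D = D' := by
  ext f
  simpa [act] using h (σ f)

/-- The exact form `df ∈ Γ(φ^! T^*M)`. -/
def exactForm (f : R) : Module.Dual R (TwistedDer σ) where
  toFun D := D.act f
  map_add' _ _ := rfl
  map_smul' _ _ := rfl

@[simp] theorem exactForm_apply (f : R) (D : TwistedDer σ) : exactForm f D = D.act f := rfl

end TwistedDer

variable {Γ : Type*} [AddCommGroup Γ] [Module ℝ Γ] [Module R Γ] [IsScalarTower ℝ R Γ]

namespace HomLieAlgebroid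

variable (H : HomLieAlgebroid σ Γ)

/-- The ordinary Lie bracket `φ_A⁻¹ [x, y]` underlying a Hom-Lie algebroid. -/
def lieBr (x y : Γ) : Γ := H.twist.symm (H.bracket x y)

theorem act_anchor_twist (x : Γ) (f : R) :
    (H.anchor (H.twist x)).act (σ f) = σ ((H.anchor x).act f) := by
  simp only [TwistedDer.act, AlgEquiv.symm_apply_apply]
  rw [← H.anchor_twist]
  simp

theorem symm_act_anchor_twist (x : Γ) (f : R) :
    σ.symm (H.anchor (H.twist x) f) = (H.anchor x).act f := by
  rw [AlgEquiv.symm_apply_eq, ← H.act_anchor_twist, TwistedDer.act_def]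
  simp

@[simp] theorem lieBr_add_left (x x' y : Γ) : H.lieBr (x + x') y = H.lieBr x y + H.lieBr x' y := by
  simp [lieBr]

@[simp] theorem lieBr_add_right (x y y' : Γ) :
    H.lieBr x (y + y') = H.lieBr x y + H.lieBr x y' := by
  simp [lieBr]

theorem lieBr_skew (x y : Γ) : H.lieBr x y = -H.lieBr y x := by
  rw [lieBr, H.bracket_skew, map_neg, lieBr]

theorem lieBr_smul_right (x y : Γ) (f : R) :
    H.lieBr x (f • y) = f • H.lieBr x y + (H.anchor x).act f • y := by
  simp [lieBr, H.leibniz, H.twist_symm_smul, H.symm_act_anchor_twist]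

theorem lieBr_smul_left (x y : Γ) (f : R) :
    H.lieBr (f • x) y = f • H.lieBr x y - (H.anchor y).act f • x := by
  rw [H.lieBr_skew, H.lieBr_smul_right, H.lieBr_skew y x]
  simp only [smul_neg, neg_add_rev, neg_neg]
  abel

theorem twist_lieBr (x y : Γ) : H.twist (H.lieBr x y) = H.lieBr (H.twist x) (H.twist y) := by
  simp [lieBr, ← H.twist_bracket]

theorem act_lieBr (x y : Γ) (f : R) :
    (H.anchor (H.lieBr x y)).act f =
      (H.anchor x).act ((H.anchor y).act f) - (H.anchor y).act ((H.anchor x).act f) := by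
  have h := LinearMap.congr_fun (H.anchor_rep.bracket x y) (σ.symm f)
  simp only [LinearMap.comp_apply, LinearMap.sub_apply, TwistedDer.toOperator_apply,
    LinearMap.restrictScalars_apply, LinearEquiv.coe_coe, AlgEquiv.toLinearMap_apply,
    AlgEquiv.apply_symm_apply] at h
  rw [← H.symm_act_anchor_twist]
  simp only [lieBr, LinearEquiv.apply_symm_apply]
  rw [h, map_sub, H.symm_act_anchor_twist, H.symm_act_anchor_twist]
  rfl

theorem tangent_twist_anchor (x : Γ) :
    (tangent σ).twist (H.anchor x) = H.anchor (H.twist x) := by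
  ext f
  change σ (H.anchor x (σ.symm f)) = _
  rw [← H.anchor_twist]
  simp

/-- The ordinary Lie derivative of `ξ ∈ Γ(A^*)` along `x ∈ Γ(A)`. -/
def lieDeriv (x : Γ) (ξ : Module.Dual R Γ) : Module.Dual R Γ where
  toFun y := (H.anchor x).act (ξ y) - ξ (H.lieBr x y)
  map_add' := by intro y z; simp; ring
  map_smul' := by intro c y; simp [H.lieBr_smul_right]; ring

@[simp] theorem lieDeriv_apply (x : Γ) (ξ : Module.Dual R Γ) (y : Γ) :
    H.lieDeriv x ξ y = (H.anchor x).act (ξ y) - ξ (H.lieBr x y) := rfl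

/-- The ordinary differential of `f`, as a section of `A^*`. -/
def diff (f : R) : Module.Dual R Γ := H.anchor.dualMap (TwistedDer.exactForm f)

@[simp] theorem diff_apply (f : R) (x : Γ) : H.diff f x = (H.anchor x).act f := rfl

theorem lieDeriv_smul (x : Γ) (ξ : Module.Dual R Γ) (f : R) :
    H.lieDeriv (f • x) ξ = f • H.lieDeriv x ξ + ξ x • H.diff f := by
  ext y
  simp [H.lieBr_smul_left]
  ring

/-- `d1` is the ordinary differential precomposed with `φ_A^†`; this is the shift that `cobr`
undoes. -/
theorem d1_eq (ξ : Module.Dual R Γ) (x y : Γ) :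
    H.d1 ξ x y = (H.anchor x).act (H.dualTwist ξ y) - (H.anchor y).act (H.dualTwist ξ x)
      - H.dualTwist ξ (H.lieBr x y) := by
  simp [d1_apply, TwistedDer.act_def, lieBr, H.twist_symm_bracket]

theorem lieForm_twist_symm (x : Γ) (ξ : Module.Dual R Γ) :
    H.lieForm x (H.dualTwist.symm ξ) = H.lieDeriv (H.twist x) ξ := by
  ext y
  simp [TwistedDer.act_def, lieBr, H.twist_symm_bracket]

/-- The Lie derivative along `x` of a bisection of `A`. -/
def lieBi (x : Γ) (X : Module.Dual R Γ →ₗ[R] Module.Dual R Γ →ₗ[R] R) (ξ η : Module.Dual R Γ) : R :=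
  (H.anchor x).act (X ξ η) - X (H.lieDeriv x ξ) η - X ξ (H.lieDeriv x η)

theorem schouten12_eq (x : Γ) (X : Module.Dual R Γ →ₗ[R] Module.Dual R Γ →ₗ[R] R)
    (ξ η : Module.Dual R Γ) :
    H.schouten12 x X ξ η = H.lieBi (H.twist x) (H.twist2 X) ξ η := by
  simp only [schouten12, lieBi, lieForm_twist_symm]
  congr 2
  simp [TwistedDer.act_def]

/-- The cobracket of the ordinary Lie bialgebroid underlying a Hom-Lie bialgebroid. -/
def cobr (H' : HomLieAlgebroid σ (Module.Dual R Γ)) (x : Γ) :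
    Module.Dual R Γ →ₗ[R] Module.Dual R Γ →ₗ[R] R :=
  H'.d1 (H'.dualTwist.symm (Module.Dual.eval R Γ x))

theorem cobr_apply (H' : HomLieAlgebroid σ (Module.Dual R Γ)) (x : Γ) (ξ η : Module.Dual R Γ) :
    H'.cobr x ξ η = (H'.anchor ξ).act (η x) - (H'.anchor η).act (ξ x) - H'.lieBr ξ η x := by
  simp only [cobr, d1_eq, LinearEquiv.apply_symm_apply, Module.Dual.eval_apply]

theorem cobr_add (H' : HomLieAlgebroid σ (Module.Dual R Γ)) (x y : Γ) (ξ η : Module.Dual R Γ) :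
    H'.cobr (x + y) ξ η = H'.cobr x ξ η + H'.cobr y ξ η := by
  simp only [cobr_apply, map_add, TwistedDer.act_add]
  ring

theorem cobr_smul (H' : HomLieAlgebroid σ (Module.Dual R Γ)) (f : R) (x : Γ)
    (ξ η : Module.Dual R Γ) :
    H'.cobr (f • x) ξ η =
      f * H'.cobr x ξ η + H'.diff f ξ * η x - H'.diff f η * ξ x := by
  simp only [cobr_apply, map_smul, smul_eq_mul, TwistedDer.act_mul, diff_apply]
  ring

end HomLieAlgebroid

/-! ### The ordinary Lie bialgebroid underlying a Hom-Lie bialgebroid. -/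

open HomLieAlgebroid

namespace IsHomLieBialgebroid

variable {H : HomLieAlgebroid σ Γ} {H' : HomLieAlgebroid σ (Module.Dual R Γ)}

theorem twist_apply (h : IsHomLieBialgebroid H H') (ξ : Module.Dual R Γ) (x : Γ) :
    H'.twist ξ x = σ (ξ (H.twist.symm x)) := by
  rw [h.dual_twist]; rfl

theorem twist_symm_apply (h : IsHomLieBialgebroid H H') (ξ : Module.Dual R Γ) (x : Γ) :
    H'.twist.symm ξ x = σ.symm (ξ (H.twist x)) := by
  rw [h.dual_twist]; rfl

theorem codiff_eq (h : IsHomLieBialgebroid H H') (x : Γ) :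
    H'.codiff x = H'.cobr (H.twist x) := by
  ext ξ η
  rw [codiff, d1_eq, cobr_apply]
  simp [h.twist_symm_apply]

/-- The twist of `A^*` is an automorphism of its untwisted Lie algebroid, so it commutes with the
differential. -/
theorem twist2_cobr (h : IsHomLieBialgebroid H H') (x : Γ) :
    H.twist2 (H'.cobr x) = H'.cobr (H.twist x) := by
  ext ξ η
  have e : ∀ ζ, H.dualTwist.symm ζ = H'.twist.symm ζ := fun ζ => by rw [h.dual_twist]
  simp only [twist2_apply, cobr_apply, map_sub, ← H'.act_anchor_twist, e,
    LinearEquiv.apply_symm_apply]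
  have hb : H'.lieBr (H'.twist.symm ξ) (H'.twist.symm η) = H'.twist.symm (H'.lieBr ξ η) := by
    rw [LinearEquiv.eq_symm_apply, H'.twist_lieBr]
    simp
  simp [hb, h.twist_symm_apply]

/-- The compatibility condition of the underlying ordinary Lie bialgebroid. -/
theorem cobr_lieBr (h : IsHomLieBialgebroid H H') (x y : Γ) (ξ η : Module.Dual R Γ) :
    H'.cobr (H.lieBr x y) ξ η = H.lieBi x (H'.cobr y) ξ η - H.lieBi y (H'.cobr x) ξ η := by
  -- After untwisting, every argument in the Hom-compatibility condition carries `φ_A²`: one factor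
  -- comes from `codiff_eq` or the explicit `φ_A`, the other from `schouten12_eq`, `twist2_cobr` or
  -- the bracket. Hence both sections are written as `φ_A²` of something.
  obtain ⟨x, rfl⟩ := H.twist.surjective x
  obtain ⟨y, rfl⟩ := H.twist.surjective y
  obtain ⟨x, rfl⟩ := H.twist.surjective x
  obtain ⟨y, rfl⟩ := H.twist.surjective y
  have := h.compat x y ξ η
  simp only [h.codiff_eq, schouten21, schouten12_eq, h.twist2_cobr] at this
  simp only [← H.twist_lieBr]
  rw [lieBr, LinearEquiv.apply_symm_apply, this]
  ring

end IsHomLieBialgebroid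

/-! ### Consequences of the compatibility condition for functions. -/

/-- `d_* f ∈ Γ(A)`. -/
def HomLieAlgebroid.codiff0 [Module.IsReflexive R Γ] (H' : HomLieAlgebroid σ (Module.Dual R Γ))
    (f : R) : Γ := H'.coanchorDual (TwistedDer.exactForm f)

theorem HomLieAlgebroid.apply_coanchorDual [Module.IsReflexive R Γ]
    (H' : HomLieAlgebroid σ (Module.Dual R Γ)) (θ : Module.Dual R (TwistedDer σ))
    (ξ : Module.Dual R Γ) : ξ (H'.coanchorDual θ) = θ (H'.anchor ξ) := by
  simp only [coanchorDual, LinearMap.comp_apply, LinearEquiv.coe_coe]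
  rw [Module.apply_evalEquiv_symm_apply]
  rfl

theorem HomLieAlgebroid.apply_codiff0 [Module.IsReflexive R Γ]
    (H' : HomLieAlgebroid σ (Module.Dual R Γ)) (f : R)
    (ξ : Module.Dual R Γ) : ξ (H'.codiff0 f) = (H'.anchor ξ).act f :=
  H'.apply_coanchorDual _ ξ

/-- A section `e` with `e ∧ y = 0` for all sections `y` vanishes. -/
def WedgeFaithful (R Γ : Type*) [CommRing R] [AddCommGroup Γ] [Module R Γ] : Prop :=
  ∀ e : Module.Dual R (Module.Dual R Γ),
    (∀ (y : Γ) (ξ η : Module.Dual R Γ), e ξ * η y = e η * ξ y) → e = 0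

namespace IsHomLieBialgebroid

variable [Module.IsReflexive R Γ]
variable {H : HomLieAlgebroid σ Γ} {H' : HomLieAlgebroid σ (Module.Dual R Γ)}

/-- `L_{df} x = [x, d_* f]`, where `L` is the Lie derivative of `A^*`. -/
theorem lieDeriv_diff (h : IsHomLieBialgebroid H H') (hw : WedgeFaithful R Γ) (f : R) (x : Γ) :
    H'.lieDeriv (H.diff f) (Module.Dual.eval R Γ x) =
      Module.Dual.eval R Γ (H.lieBr x (H'.codiff0 f)) := by
  rw [← sub_eq_zero]
  apply hw
  intro y ξ η
  -- The compatibility defect of `(x, f y)` minus `f` times that of `(x, y)` is a wedge with `y`: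
  -- the terms in which `f` is differentiated are all that survives.
  have h1 := h.cobr_lieBr x (f • y) ξ η
  have h2 := h.cobr_lieBr x y ξ η
  have h3 : ∀ ζ, H'.diff f (H.lieDeriv x ζ) =
      (H.anchor x).act ((H'.anchor ζ).act f) - ζ (H.lieBr x (H'.codiff0 f)) := by
    intro ζ
    rw [diff_apply, ← apply_codiff0, lieDeriv_apply, apply_codiff0]
  have h4 : ∀ ζ, H'.cobr x (H.diff f) ζ = (H'.anchor (H.diff f)).act (ζ x)
      - (H'.anchor ζ).act ((H.anchor x).act f) - H'.lieBr (H.diff f) ζ x := by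
    intro ζ
    rw [cobr_apply, diff_apply]
  have h5 : ∀ ζ, H'.cobr x ζ (H.diff f) = -H'.cobr x (H.diff f) ζ := by
    intro ζ
    rw [cobr_apply, cobr_apply, H'.lieBr_skew (H.diff f) ζ, LinearMap.neg_apply]
    ring
  simp only [H.lieBr_smul_right, lieBi, H.lieDeriv_smul, cobr_add, cobr_smul, map_add, map_smul,
    LinearMap.add_apply, LinearMap.smul_apply, smul_eq_mul, TwistedDer.act_add,
    TwistedDer.act_sub, TwistedDer.act_mul, TwistedDer.smul_act, h3, h5, h4, lieDeriv_apply,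
    diff_apply] at h1 h2
  simp only [LinearMap.sub_apply, lieDeriv_apply, Module.Dual.eval_apply]
  linear_combination h1 - f * h2

theorem anchor_diff_add (h : IsHomLieBialgebroid H H') (hw : WedgeFaithful R Γ) [IsReduced R]
    (f g : R) : (H'.anchor (H.diff f)).act g = -(H.anchor (H'.codiff0 f)).act g := by
  -- In `L_{df}(g x) = [g x, d_* f]` the left side produces the extra term `a_{A^*}(df)(g) x`, the
  -- right side `-a_A(d_* f)(g) x`.
  have key : ∀ (ξ : Module.Dual R Γ) (x : Γ),
      ((H'.anchor (H.diff f)).act g + (H.anchor (H'.codiff0 f)).act g) * ξ x = 0 := by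
    intro ξ x
    have h1 := LinearMap.congr_fun (h.lieDeriv_diff hw f (g • x)) ξ
    have h2 := LinearMap.congr_fun (h.lieDeriv_diff hw f x) ξ
    simp only [lieDeriv_apply, Module.Dual.eval_apply] at h1 h2
    rw [H.lieBr_smul_left] at h1
    rw [map_smul, map_sub, map_smul, map_smul, map_smul, smul_eq_mul, smul_eq_mul, smul_eq_mul,
      smul_eq_mul, TwistedDer.act_mul] at h1
    linear_combination h1 - g * h2
  -- The pairings `⟨df, d_* g⟩` and `⟨dg, d_* f⟩` are exactly the two summands of the factor in
  -- `key`. Adding the two instances shows that its square vanishes, and `R` is reduced.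
  have h1 := key (H.diff f) (H'.codiff0 g)
  have h2 := key (H.diff g) (H'.codiff0 f)
  rw [apply_codiff0] at h1
  rw [diff_apply] at h2
  rw [eq_neg_iff_add_eq_zero]
  apply IsReduced.eq_zero _ ⟨2, _⟩
  linear_combination h1 + h2

/-- The left side is `⟨df, d_* g⟩`, which is also `a_{A^*}(df)(g)`. -/
theorem anchor_codiff0_skew (h : IsHomLieBialgebroid H H') (hw : WedgeFaithful R Γ) [IsReduced R]
    (f g : R) : (H.anchor (H'.codiff0 g)).act f = -(H.anchor (H'.codiff0 f)).act g := by
  rw [← h.anchor_diff_add hw, ← apply_codiff0, diff_apply]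

/-- This is `lieDeriv_diff` at `x = d_* g`, paired with `ξ`; `act_lieBr` expands the anchor of `[df,
ξ]` as a commutator. -/
theorem codiff0_poisson (h : IsHomLieBialgebroid H H') (hw : WedgeFaithful R Γ) [IsReduced R]
    (f g : R) : H'.codiff0 ((H.anchor (H'.codiff0 f)).act g) =
      H.lieBr (H'.codiff0 f) (H'.codiff0 g) := by
  apply (Module.evalEquiv R Γ).injective
  ext ξ
  simp only [Module.evalEquiv_apply]
  have h1 := LinearMap.congr_fun (h.lieDeriv_diff hw f (H'.codiff0 g)) ξ
  simp only [lieDeriv_apply, Module.Dual.eval_apply, apply_codiff0, act_lieBr,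
    h.anchor_diff_add hw] at h1
  rw [Module.Dual.eval_apply, Module.Dual.eval_apply, apply_codiff0, H.lieBr_skew, map_neg, ← h1]
  simp

/-- Acting on a function `f`, both sides become `θ` evaluated on a derivation depending on `f`
alone, so `anchor_diff_add` settles arbitrary `θ` without any local exactness. -/
theorem piSharp_eq_neg (h : IsHomLieBialgebroid H H') (hw : WedgeFaithful R Γ) [IsReduced R] :
    piSharp H H' = -piBarSharp H H' := by
  ext1 θ
  apply TwistedDer.ext_act
  intro f
  change H.diff f (H'.coanchorDual θ) = -(H'.anchor (H.anchor.dualMap θ)).act f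
  rw [apply_coanchorDual, ← apply_codiff0]
  have : H'.anchor (H.diff f) = -H.anchor (H'.codiff0 f) :=
    TwistedDer.ext_act fun g => h.anchor_diff_add hw f g
  rw [this, map_neg]
  rfl

/-- Skew-symmetry of `π` when one of the two forms is exact. -/
theorem piSharp_act (h : IsHomLieBialgebroid H H') (hw : WedgeFaithful R Γ) [IsReduced R]
    (θ : Module.Dual R (TwistedDer σ)) (f : R) :
    (piSharp H H' θ).act f = -θ (H.anchor (H'.codiff0 f)) := by
  rw [h.piSharp_eq_neg hw, LinearMap.neg_apply, TwistedDer.neg_act, neg_inj]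
  exact (H'.apply_codiff0 f (H.anchor.dualMap θ)).symm

theorem piSharp_twist (h : IsHomLieBialgebroid H H') (θ : Module.Dual R (TwistedDer σ)) :
    (tangent σ).twist (piSharp H H' ((tangent σ).dualTwist.symm θ)) = piSharp H H' θ := by
  have hco : H'.coanchorDual ((tangent σ).dualTwist.symm θ) =
      H.twist.symm (H'.coanchorDual θ) := by
    apply (Module.evalEquiv R Γ).injective
    ext ξ
    rw [Module.evalEquiv_apply, Module.evalEquiv_apply, Module.Dual.eval_apply,
      Module.Dual.eval_apply, apply_coanchorDual, InvHomBundle.dualTwist_symm_apply, HomLieAlgebroid.tangent_twist_anchor,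
      ← apply_coanchorDual, h.twist_apply]
    simp
  change (tangent σ).twist (H.anchor _) = H.anchor _
  rw [HomLieAlgebroid.tangent_twist_anchor, hco, LinearEquiv.apply_symm_apply]

end IsHomLieBialgebroid

/-! ### Reduction to exact forms, and the Jacobiator. -/

/-- Every `R`-linear form on the twisted derivations is locally a combination of exact forms. -/
def LocallyExact (σ : R ≃ₐ[ℝ] R) : Prop :=
  ∀ (θ : Module.Dual R (TwistedDer σ)) (a : R),
    (∀ r : R, r • θ ∈ Submodule.span R (Set.range (TwistedDer.exactForm (σ := σ))) → r * a = 0) →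
      a = 0

theorem LocallyExact.eq_zero (hσ : LocallyExact σ)
    (L : Module.Dual R (TwistedDer σ) →ₗ[R] R)
    (hL : ∀ f, L (TwistedDer.exactForm f) = 0) (θ : Module.Dual R (TwistedDer σ)) : L θ = 0 := by
  apply hσ θ
  intro r hr
  have hle : Submodule.span R (Set.range (TwistedDer.exactForm (σ := σ))) ≤ LinearMap.ker L := by
    rw [Submodule.span_le]
    rintro _ ⟨f, rfl⟩
    exact hL f
  simpa using hle hr

namespace TwistedDer

variable (P : Module.Dual R (TwistedDer σ) →ₗ[R] TwistedDer σ)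

/-- The Jacobiator of a bundle map `φ^! T^*M → φ^! TM`. -/
def jacobiator (θ₁ θ₂ θ₃ : Module.Dual R (TwistedDer σ)) : R :=
  θ₁ ((tangent σ).lieBr (P θ₂) (P θ₃)) + θ₂ ((tangent σ).lieBr (P θ₃) (P θ₁))
    + θ₃ ((tangent σ).lieBr (P θ₁) (P θ₂))
    - (P θ₁).act (θ₃ (P θ₂)) - (P θ₂).act (θ₁ (P θ₃)) - (P θ₃).act (θ₂ (P θ₁))

theorem jacobiator_rotate (θ₁ θ₂ θ₃ : Module.Dual R (TwistedDer σ)) :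
    jacobiator P θ₁ θ₂ θ₃ = jacobiator P θ₂ θ₃ θ₁ := by
  simp only [jacobiator]
  ring

theorem tangent_anchor_act (D : TwistedDer σ) (f : R) :
    ((tangent σ).anchor D).act f = D.act f := rfl

theorem lieBr_act (D D' : TwistedDer σ) (f : R) :
    ((tangent σ).lieBr D D').act f = D.act (D'.act f) - D'.act (D.act f) :=
  (tangent σ).act_lieBr D D' f

variable {P}

/-- The Jacobiator of a skew-symmetric map, as a linear map in its first argument. -/
def jacobiatorLin (hP : ∀ θ η : Module.Dual R (TwistedDer σ), η (P θ) = -θ (P η)) (θ₂ θ₃ : Module.Dual R (TwistedDer σ)) :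
    Module.Dual R (TwistedDer σ) →ₗ[R] R where
  toFun θ₁ := jacobiator P θ₁ θ₂ θ₃
  map_add' := by
    intro θ θ'
    simp [jacobiator]
    ring
  map_smul' := by
    intro c θ
    simp only [jacobiator, map_smul, HomLieAlgebroid.lieBr_smul_left,
      HomLieAlgebroid.lieBr_smul_right, tangent_anchor_act, map_add, map_sub, act_mul,
      smul_act, LinearMap.smul_apply, smul_eq_mul, RingHom.id_apply]
    -- The derivatives of `c` along `P θ₃` cancel outright; those along `P θ₂` have the coefficient
    -- `θ₃ (P θ) + θ (P θ₃)`, which vanishes by skew-symmetry.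
    rw [hP θ₃ θ]
    ring

/-- Cyclic symmetry brings each slot in turn to the first place, where linearity and local exactness
reduce it to exact forms. -/
theorem jacobiator_eq_zero (hσ : LocallyExact σ)
    (hP : ∀ θ η : Module.Dual R (TwistedDer σ), η (P θ) = -θ (P η))
    (h : ∀ θ f g, jacobiator P θ (exactForm f) (exactForm g) = 0)
    (θ₁ θ₂ θ₃ : Module.Dual R (TwistedDer σ)) : jacobiator P θ₁ θ₂ θ₃ = 0 := by
  have h2 : ∀ θ η f, jacobiator P θ η (exactForm f) = 0 := by
    intro θ η f
    refine hσ.eq_zero (jacobiatorLin hP η (exactForm f)) (fun g => ?_) θ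
    exact (jacobiator_rotate ..).trans (h ..)
  rw [jacobiator_rotate, jacobiator_rotate]
  refine hσ.eq_zero (jacobiatorLin hP θ₁ θ₂) (fun g => ?_) θ₃
  exact (jacobiator_rotate ..).trans (h2 ..)

/-- Equal arguments double each of the three terms. In the cyclic sum the first two derivative terms
of `key` cancel, and skew-symmetry turns the third into the derivative terms of the Jacobiator. -/
theorem schouten22_eq_jacobiator
    (hP : ∀ θ η : Module.Dual R (TwistedDer σ), η (P θ) = -θ (P η))
    (θ₁ θ₂ θ₃ : Module.Dual R (TwistedDer σ)) :
    (tangent σ).schouten22 (Module.Dual.eval R (TwistedDer σ) ∘ₗ P)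
      (Module.Dual.eval R (TwistedDer σ) ∘ₗ P) θ₁ θ₂ θ₃ =
    2 * σ (jacobiator P ((tangent σ).dualTwist.symm θ₁) ((tangent σ).dualTwist.symm θ₂)
      ((tangent σ).dualTwist.symm θ₃)) := by
  have key : ∀ η₁ η₂ η₃ : Module.Dual R (TwistedDer σ),
      (tangent σ).schouten22Term (Module.Dual.eval R (TwistedDer σ) ∘ₗ P)
        (Module.Dual.eval R (TwistedDer σ) ∘ₗ P) η₁ η₂ η₃ =
      2 * ((P η₁).act (η₃ (P η₂)) - (P η₂).act (η₁ (P η₃)) + (P η₃).act (η₁ (P η₂))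
        + η₁ ((tangent σ).lieBr (P η₂) (P η₃))) := by
    intro η₁ η₂ η₃
    have hb : ∀ x y : TwistedDer σ, bidualEval
        ((tangent σ).d1 ((tangent σ).dualTwist.symm η₁))
          (Module.Dual.eval R (TwistedDer σ) x) (Module.Dual.eval R (TwistedDer σ) y) =
        x.act (η₁ y) - y.act (η₁ x) - η₁ ((tangent σ).lieBr x y) := by
      intro x y
      change (tangent σ).d1 _ x y = _
      rw [HomLieAlgebroid.d1_eq, LinearEquiv.apply_symm_apply]
      rfl
    simp only [HomLieAlgebroid.schouten22Term, LinearMap.comp_apply, hb]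
    have hd : ∀ x y : TwistedDer σ, Module.Dual.eval R (TwistedDer σ) x
        ((tangent σ).d0 (σ.symm (Module.Dual.eval R (TwistedDer σ) y η₃))) = x.act (η₃ y) :=
      fun _ _ => rfl
    rw [hd, (tangent σ).lieBr_skew (P η₃), map_neg]
    ring
  have h2 : (2 : R) = σ 2 := (map_ofNat σ 2).symm
  rw [HomLieAlgebroid.schouten22, h2, ← map_mul]
  simp only [key, jacobiator]
  generalize (tangent σ).dualTwist.symm θ₁ = η₁
  generalize (tangent σ).dualTwist.symm θ₂ = η₂
  generalize (tangent σ).dualTwist.symm θ₃ = η₃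
  rw [hP η₁ η₂, hP η₂ η₃, hP η₃ η₁]
  simp only [act_neg]
  congr 1
  ring

/-- A skew-symmetric, invariant map with vanishing Jacobiator defines a Hom-Poisson structure. -/
theorem definesHomPoisson_of_jacobiator
    (hP : ∀ θ η : Module.Dual R (TwistedDer σ), η (P θ) = -θ (P η))
    (ht : ∀ θ, (tangent σ).twist (P ((tangent σ).dualTwist.symm θ)) = P θ)
    (hJ : ∀ θ₁ θ₂ θ₃, jacobiator P θ₁ θ₂ θ₃ = 0) : DefinesHomPoisson P where
  alt θ := by
    change θ (P θ) = 0
    have h2 : (2 : ℝ) • θ (P θ) = 0 := by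
      rw [two_smul, ← eq_neg_iff_add_eq_zero]
      exact hP θ θ
    simpa using congrArg (fun a => (2⁻¹ : ℝ) • a) h2
  twist := by
    ext θ η
    rw [HomLieAlgebroid.twist2_apply]
    change σ ((tangent σ).dualTwist.symm η (P ((tangent σ).dualTwist.symm θ))) = η (P θ)
    rw [InvHomBundle.dualTwist_symm_apply, ht, AlgEquiv.apply_symm_apply]
  schouten θ₁ θ₂ θ₃ := by
    rw [schouten22_eq_jacobiator hP, hJ, map_zero, mul_zero]

end TwistedDer

/-! ### The Hom-Poisson structure of a Hom-Lie bialgebroid. -/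

namespace IsHomLieBialgebroid

variable [Module.IsReflexive R Γ]
variable {H : HomLieAlgebroid σ Γ} {H' : HomLieAlgebroid σ (Module.Dual R Γ)}

theorem piSharp_skew (h : IsHomLieBialgebroid H H') (hw : WedgeFaithful R Γ) [IsReduced R]
    (hσ : LocallyExact σ) (θ η : Module.Dual R (TwistedDer σ)) :
    η (piSharp H H' θ) = -θ (piSharp H H' η) := by
  rw [eq_neg_iff_add_eq_zero]
  let L : Module.Dual R (TwistedDer σ) →ₗ[R] R :=
    Module.Dual.eval R (TwistedDer σ) (piSharp H H' θ) + θ ∘ₗ piSharp H H'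
  refine hσ.eq_zero L (fun f => ?_) η
  change (piSharp H H' θ).act f + θ (H.anchor (H'.codiff0 f)) = 0
  rw [h.piSharp_act hw]
  ring

/-- For `(θ, df, dg)`, `codiff0_poisson` gives `[P df, P dg] = P d{f, g}`. With `θ (P dk) = -(P
θ)(k)`, the terms differentiating `(P θ)(f)` or `(P θ)(g)` cancel, and what is left are copies of
`(P θ){f, g}` with total coefficient zero. -/
theorem piSharp_jacobiator (h : IsHomLieBialgebroid H H') (hw : WedgeFaithful R Γ) [IsReduced R]
    (hσ : LocallyExact σ) (θ₁ θ₂ θ₃ : Module.Dual R (TwistedDer σ)) :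
    TwistedDer.jacobiator (piSharp H H') θ₁ θ₂ θ₃ = 0 := by
  refine TwistedDer.jacobiator_eq_zero hσ (h.piSharp_skew hw hσ) (fun θ f g => ?_) θ₁ θ₂ θ₃
  have hex : ∀ f, piSharp H H' (TwistedDer.exactForm f) = H.anchor (H'.codiff0 f) := fun _ => rfl
  have hbr : (tangent σ).lieBr (H.anchor (H'.codiff0 f)) (H.anchor (H'.codiff0 g)) =
      H.anchor (H'.codiff0 ((H.anchor (H'.codiff0 f)).act g)) := by
    apply TwistedDer.ext_act
    intro k
    rw [h.codiff0_poisson hw, H.act_lieBr, TwistedDer.lieBr_act]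
  have hθ : ∀ k, θ (H.anchor (H'.codiff0 k)) = -(piSharp H H' θ).act k := fun k => by
    rw [h.piSharp_act hw, neg_neg]
  simp only [TwistedDer.jacobiator, hex, hbr, TwistedDer.exactForm_apply, TwistedDer.lieBr_act,
    hθ, TwistedDer.act_neg]
  rw [h.anchor_codiff0_skew hw f g, TwistedDer.act_neg]
  ring

theorem definesHomPoisson_piSharp (h : IsHomLieBialgebroid H H') (hw : WedgeFaithful R Γ)
    [IsReduced R] (hσ : LocallyExact σ) : DefinesHomPoisson (piSharp H H') :=
  TwistedDer.definesHomPoisson_of_jacobiator (h.piSharp_skew hw hσ) h.piSharp_twist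
    (h.piSharp_jacobiator hw hσ)

end IsHomLieBialgebroid

/-- The Schouten bracket is quadratic in `π`, the other two conditions are linear. -/
theorem DefinesHomPoisson.neg {P : Module.Dual R (TwistedDer σ) →ₗ[R] TwistedDer σ}
    (hP : DefinesHomPoisson P) : DefinesHomPoisson (-P) := by
  rw [DefinesHomPoisson, LinearMap.comp_neg]
  refine ⟨fun θ => ?_, ?_, fun θ₁ θ₂ θ₃ => ?_⟩
  · simpa using hP.alt θ
  · ext θ η
    have := LinearMap.congr_fun₂ hP.twist θ η
    simp only [HomLieAlgebroid.twist2_apply, LinearMap.neg_apply, map_neg] at this ⊢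
    rw [this]
  · rw [← hP.schouten θ₁ θ₂ θ₃]
    have hn : ∀ g : R, (tangent σ).d0 (-g) = -(tangent σ).d0 g := fun g => by ext; simp
    simp only [HomLieAlgebroid.schouten22, HomLieAlgebroid.schouten22Term, bidualEval,
      LinearMap.neg_apply, map_neg, hn, neg_neg, LinearMap.neg_comp]

end Untwist

/-! ### Hadamard's lemma in a vector space. -/

section Hadamard

universe u

variable {E : Type u} [NormedAddCommGroup E] [NormedSpace ℝ E] [FiniteDimensional ℝ E]

-- Differentiating under the integral replaces `G` by `E →L[ℝ] G`, so the induction runs over all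
-- `G`; `E` and `G` share a universe to keep this space in range.
open MeasureTheory intervalIntegral in
theorem contDiff_parametric_integral_nat {G : Type u} [NormedAddCommGroup G] [NormedSpace ℝ G]
    [CompleteSpace G] (n : ℕ) (Φ : E → ℝ → G) (hΦ : ContDiff ℝ n (Function.uncurry Φ)) :
    ContDiff ℝ n (fun y => ∫ t in (0 : ℝ)..1, Φ y t) := by
  induction n generalizing G with
  | zero =>
    rw [Nat.cast_zero, contDiff_zero] at *
    exact continuous_parametric_intervalIntegral_of_continuous' hΦ 0 1
  | succ n ih =>
    have hd : Differentiable ℝ (Function.uncurry Φ) := hΦ.differentiable (by simp)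
    let Φ' : E → ℝ → (E →L[ℝ] G) := fun y t =>
      (fderiv ℝ (Function.uncurry Φ) (y, t)).comp (ContinuousLinearMap.inl ℝ E ℝ)
    have hΦ' : ContDiff ℝ n (Function.uncurry Φ') := by
      have h1 : ContDiff ℝ n (fderiv ℝ (Function.uncurry Φ)) :=
        hΦ.fderiv_right (by norm_cast)
      exact h1.clm_comp contDiff_const
    have hderiv : ∀ y t, HasFDerivAt (fun y => Φ y t) (Φ' y t) y := by
      intro y t
      exact (hd (y, t)).hasFDerivAt.comp (f := fun y => (y, t)) y (hasFDerivAt_prodMk_left y t)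
    have hc : ∀ y, Continuous (Φ y) := fun y =>
      hΦ.continuous.comp (f := fun t => (y, t)) (by fun_prop)
    have hc' : ∀ y, Continuous (Φ' y) := fun y =>
      hΦ'.continuous.comp (f := fun t => (y, t)) (by fun_prop)
    rw [Nat.cast_succ, contDiff_succ_iff_hasFDerivAt]
    refine ⟨fun y => ∫ t in (0 : ℝ)..1, Φ' y t, ih Φ' hΦ', fun y₀ => ?_⟩
    -- Closed balls are compact in finite dimension, so a constant dominates the derivative.
    obtain ⟨C, hC⟩ := ((isCompact_closedBall y₀ 1).prod (isCompact_Icc (a := (0 : ℝ)) (b := 1))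
      ).exists_bound_of_continuousOn hΦ'.continuous.continuousOn
    refine hasFDerivAt_integral_of_dominated_of_fderiv_le (bound := fun _ => C)
      (Metric.closedBall_mem_nhds y₀ one_pos)
      (Filter.Eventually.of_forall fun y => (hc y).aestronglyMeasurable)
      ((hc y₀).intervalIntegrable _ _) (hc' y₀).aestronglyMeasurable ?_
      intervalIntegrable_const (Filter.Eventually.of_forall fun t _ y _ => hderiv y t)
    refine Filter.Eventually.of_forall fun t ht y hy => hC (y, t) ⟨hy, ?_⟩
    rw [Set.uIoc_of_le zero_le_one] at ht
    exact ⟨ht.1.le, ht.2⟩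

/-- Integrals of smooth functions depending smoothly on a parameter are smooth. -/
theorem contDiff_parametric_integral {G : Type u} [NormedAddCommGroup G] [NormedSpace ℝ G]
    [CompleteSpace G] (Φ : E → ℝ → G) (hΦ : ContDiff ℝ ∞ (Function.uncurry Φ)) :
    ContDiff ℝ ∞ (fun y => ∫ t in (0 : ℝ)..1, Φ y t) :=
  contDiff_infty.2 fun n => contDiff_parametric_integral_nat n Φ (contDiff_infty.1 hΦ n)

/-- Hadamard's lemma. -/
theorem exists_hadamard {g : E → ℝ} (hg : ContDiff ℝ ∞ g) (p : E) :
    ∃ h : E → (E →L[ℝ] ℝ), ContDiff ℝ ∞ h ∧ h p = fderiv ℝ g p ∧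
      ∀ y, g y = g p + h y (y - p) := by
  -- The coefficient is the mean of the derivative of `g` over the segment from `p` to `y`.
  let Φ : E → ℝ → (E →L[ℝ] ℝ) := fun y t => fderiv ℝ g (p + t • (y - p))
  have hΦ : ContDiff ℝ ∞ (Function.uncurry Φ) := by
    have h1 : ContDiff ℝ ∞ (fderiv ℝ g) := hg.fderiv_right (by simp)
    exact h1.comp (f := fun q : E × ℝ => p + q.2 • (q.1 - p)) (by fun_prop)
  refine ⟨_, contDiff_parametric_integral Φ hΦ, by simp [Φ], fun y => ?_⟩
  have hcont : Continuous (Φ y) := hΦ.continuous.comp (f := fun t => (y, t)) (by fun_prop)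
  have hder : ∀ t ∈ Set.uIcc (0 : ℝ) 1,
      HasDerivAt (fun t : ℝ => g (p + t • (y - p))) (Φ y t (y - p)) t := by
    intro t _
    have h1 : HasDerivAt (fun t : ℝ => p + t • (y - p)) (y - p) t := by
      simpa using ((hasDerivAt_id t).smul_const (y - p)).const_add p
    exact ((hg.differentiable (by simp)) _).hasFDerivAt.comp_hasDerivAt t h1
  have hint := intervalIntegral.integral_eq_sub_of_hasDerivAt hder
    ((hcont.clm_apply continuous_const).intervalIntegrable _ _)
  have happ := ContinuousLinearMap.intervalIntegral_apply
    (hcont.intervalIntegrable (μ := MeasureTheory.volume) 0 1) (y - p)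
  change g y = g p + (∫ t in (0 : ℝ)..1, Φ y t) (y - p)
  rw [happ, hint]
  simp

end Hadamard

/-! ### Derivations of smooth functions in local coordinates. -/

section Coordinates

set_option linter.unusedSectionVars false

variable {E : Type*} [NormedAddCommGroup E] [NormedSpace ℝ E] [FiniteDimensional ℝ E]
  {M : Type*} [TopologicalSpace M] [ChartedSpace E M] [IsManifold 𝓘(ℝ, E) ∞ M] [T2Space M]

local notation "C∞M" => C^∞⟮𝓘(ℝ, E), M; 𝓘(ℝ, ℝ), ℝ⟯

theorem contMDiffMap_sum_apply {ι : Type*} (s : Finset ι) (f : ι → C∞M) (m : M) :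
    (∑ i ∈ s, f i) m = ∑ i ∈ s, f i m :=
  map_sum (ContMDiffMap.evalRingHom (I := 𝓘(ℝ, E)) (n := ∞) m) f s

theorem exists_bump_of_mem_nhds {m : M} {U : Set M} (hU : U ∈ nhds m) :
    ∃ χ : SmoothBumpFunction 𝓘(ℝ, E) m, tsupport χ ⊆ U := by
  obtain ⟨χ, -, hχ⟩ :=
    (SmoothBumpFunction.nhds_basis_tsupport (I := 𝓘(ℝ, E)) (c := m)).mem_iff.1 hU
  exact ⟨χ, hχ⟩

/-- Derivations of `C^∞(M)` are local operators. -/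
theorem derivation_apply_congr (D : Derivation ℝ C∞M C∞M) {f g : C∞M} {m : M}
    (h : ∀ᶠ m' in nhds m, f m' = g m') : D f m = D g m := by
  obtain ⟨χ, hχ⟩ := exists_bump_of_mem_nhds (E := E) h
  let β : C∞M := ⟨χ, χ.contMDiff⟩
  -- Applying `D` to this product and evaluating at `m`, where `β = 1` and `f - g = 0`, leaves `D f
  -- m - D g m`.
  have h0 : β * (f - g) = 0 := by
    ext m'
    change χ m' * (f m' - g m') = 0
    by_cases hm : m' ∈ tsupport χ
    · have : f m' = g m' := hχ hm
      rw [this, sub_self, mul_zero]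
    · rw [image_eq_zero_of_notMem_tsupport hm, zero_mul]
  have h1 := congrArg (fun u : C∞M => u m) (congrArg D h0)
  simp only [Derivation.leibniz, map_zero, map_sub] at h1
  have h2 : χ m * (D f m - D g m) + (f m - g m) * D β m = 0 := h1
  rw [χ.eq_one, h.self_of_nhds] at h2
  linarith

theorem contDiffOn_writtenInChart (f : C∞M) (m₀ : M) :
    ContDiffOn ℝ ∞ (f ∘ (extChartAt 𝓘(ℝ, E) m₀).symm) (extChartAt 𝓘(ℝ, E) m₀).target :=
  (f.contMDiff.comp_contMDiffOn (contMDiffOn_extChartAt_symm m₀)).contDiffOn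

variable {m₀ : M} (χ : SmoothBumpFunction 𝓘(ℝ, E) m₀)

/-- The function `χ • (h ∘ ψ)` on `M` for the chart `ψ` at `m₀`, a bump function `χ` supported in
its domain and a function `h` which is smooth on its range. -/
def chartFun (h : E → ℝ) (hh : ContDiffOn ℝ ∞ h (extChartAt 𝓘(ℝ, E) m₀).target) : C∞M :=
  ⟨fun m => χ m • h (extChartAt 𝓘(ℝ, E) m₀ m), χ.contMDiff_smul <|
    hh.contMDiffOn.comp contMDiffOn_extChartAt fun m hm => by
      rw [← extChartAt_source 𝓘(ℝ, E)] at hm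
      exact (extChartAt 𝓘(ℝ, E) m₀).map_source hm⟩

theorem chartFun_apply (h : E → ℝ) (hh : ContDiffOn ℝ ∞ h (extChartAt 𝓘(ℝ, E) m₀).target) (m : M) :
    chartFun χ h hh m = χ m * h (extChartAt 𝓘(ℝ, E) m₀ m) := rfl

theorem mem_source_of_bump_ne_zero {m : M} (hm : χ m ≠ 0) :
    m ∈ (extChartAt 𝓘(ℝ, E) m₀).source := by
  rw [extChartAt_source]
  exact χ.support_subset_source hm

theorem differentiableAt_writtenInChart (f : C∞M) {m : M} (hm : χ m ≠ 0) :
    DifferentiableAt ℝ (f ∘ (extChartAt 𝓘(ℝ, E) m₀).symm) (extChartAt 𝓘(ℝ, E) m₀ m) :=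
  ((contDiffOn_writtenInChart f m₀).contDiffAt ((isOpen_extChartAt_target m₀).mem_nhds
    ((extChartAt 𝓘(ℝ, E) m₀).map_source (mem_source_of_bump_ne_zero χ hm)))).differentiableAt
      (by simp)

/-- The cut-off of the derivative along a constant vector field in a chart. -/
def chartDeriv (v : E) : Derivation ℝ C∞M C∞M :=
  Derivation.mk'
    { toFun := fun f => chartFun χ
        (fun y => fderiv ℝ (f ∘ (extChartAt 𝓘(ℝ, E) m₀).symm) y v)
        (((contDiffOn_writtenInChart f m₀).fderiv_of_isOpen (isOpen_extChartAt_target m₀)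
          (by simp)).clm_apply contDiffOn_const)
      map_add' := by
        intro f g
        ext m
        change χ m * fderiv ℝ (f ∘ (extChartAt 𝓘(ℝ, E) m₀).symm
          + g ∘ (extChartAt 𝓘(ℝ, E) m₀).symm) (extChartAt 𝓘(ℝ, E) m₀ m) v =
            χ m * _ + χ m * _
        by_cases hm : χ m = 0
        · simp [hm]
        · rw [fderiv_add (differentiableAt_writtenInChart χ f hm)
            (differentiableAt_writtenInChart χ g hm), ← mul_add]
          rfl
      map_smul' := by
        intro c f
        ext m
        change χ m * fderiv ℝ (c • (f ∘ (extChartAt 𝓘(ℝ, E) m₀).symm))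
          (extChartAt 𝓘(ℝ, E) m₀ m) v = c * (χ m * _)
        rw [fderiv_const_smul_field]
        exact mul_left_comm _ _ _ }
    (by
      intro f g
      ext m
      change χ m * fderiv ℝ ((f ∘ (extChartAt 𝓘(ℝ, E) m₀).symm)
          * (g ∘ (extChartAt 𝓘(ℝ, E) m₀).symm)) (extChartAt 𝓘(ℝ, E) m₀ m) v =
        f m * (χ m * _) + g m * (χ m * _)
      by_cases hm : χ m = 0
      · simp [hm]
      · rw [fderiv_mul (differentiableAt_writtenInChart χ f hm)
          (differentiableAt_writtenInChart χ g hm)]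
        have hl := (extChartAt 𝓘(ℝ, E) m₀).left_inv (mem_source_of_bump_ne_zero χ hm)
        simp only [Function.comp_apply, hl, add_apply, smul_apply, smul_eq_mul]
        ring)

theorem chartDeriv_apply (v : E) (f : C∞M) (m : M) :
    chartDeriv χ v f m =
      χ m * fderiv ℝ (f ∘ (extChartAt 𝓘(ℝ, E) m₀).symm) (extChartAt 𝓘(ℝ, E) m₀ m) v := rfl

/-- Hadamard's lemma on a manifold. -/
theorem exists_hadamard_chart {ι : Type*} [Fintype ι] (b : Module.Basis ι ℝ E) (f : C∞M) {m : M}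
    (hm : ∀ᶠ m' in nhds m, χ m' = 1) :
    ∃ h : ι → C∞M, (∀ i, h i m = chartDeriv χ (b i) f m) ∧
      ∀ᶠ m' in nhds m, f m' = f m + ∑ i, (b.coord i (extChartAt 𝓘(ℝ, E) m₀ m') -
        b.coord i (extChartAt 𝓘(ℝ, E) m₀ m)) * h i m' := by
  set ψ := extChartAt 𝓘(ℝ, E) m₀ with hψ
  have hms : m ∈ ψ.source := mem_source_of_bump_ne_zero χ (by rw [hm.self_of_nhds]; simp)
  have hopen : IsOpen ψ.target := isOpen_extChartAt_target m₀
  have hψm : ψ m ∈ ψ.target := ψ.map_source hms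
  obtain ⟨ε, hε, hball⟩ := Metric.nhds_basis_closedBall.mem_iff.1 (hopen.mem_nhds hψm)
  -- `f ∘ ψ.symm` is controlled only on the target of the chart; cutting it off inside a closed ball
  -- there gives a function smooth on all of `E` with the same germ at `ψ m`.
  let β : ContDiffBump (ψ m) := ⟨ε / 2, ε, by positivity, by linarith⟩
  let g : E → ℝ := fun y => β y * f (ψ.symm y)
  have hg : ContDiff ℝ ∞ g := by
    rw [contDiff_iff_contDiffAt]
    intro y
    by_cases hy : y ∈ ψ.target
    · exact β.contDiff.contDiffAt.mul
        ((contDiffOn_writtenInChart f m₀).contDiffAt (hopen.mem_nhds hy))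
    · have hy' : y ∉ tsupport β := by
        rw [β.tsupport_eq]
        exact fun h => hy (hball h)
      refine (contDiffAt_const (c := (0 : ℝ))).congr_of_eventuallyEq ?_
      filter_upwards [notMem_tsupport_iff_eventuallyEq.1 hy'] with z hz
      simp [g, hz]
  have hgf : g =ᶠ[nhds (ψ m)] f ∘ ψ.symm := by
    filter_upwards [β.eventuallyEq_one] with z hz
    simp [g, hz]
  obtain ⟨h, hh, hhp, hhy⟩ := exists_hadamard hg (ψ m)
  refine ⟨fun i => chartFun χ (fun y => h y (b i)) (hh.clm_apply contDiff_const).contDiffOn,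
    fun i => ?_, ?_⟩
  · rw [chartFun_apply, chartDeriv_apply, hhp, hgf.fderiv_eq]
  · have hcont : ContinuousAt ψ m := continuousAt_extChartAt' hms
    filter_upwards [hm, hcont.eventually hgf,
      (isOpen_extChartAt_source m₀).mem_nhds hms] with m' h1 h2 h3
    have e1 : g (ψ m') = f m' := by
      rw [h2, Function.comp_apply, ψ.left_inv h3]
    have e2 : g (ψ m) = f m := by
      rw [hgf.self_of_nhds, Function.comp_apply, ψ.left_inv hms]
    rw [← e1, ← e2, hhy (ψ m')]
    congr 1
    conv_lhs => rw [← b.sum_repr (ψ m' - ψ m)]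
    simp only [map_sum, map_smul, smul_eq_mul, chartFun_apply, h1, one_mul, ← map_sub]
    rfl

/-- Near each point the derivations of `C^∞(M)` are combinations of coordinate derivations. -/
theorem exists_coordinates (m₀ : M) :
    ∃ (n : ℕ) (χ : C∞M) (x : Fin n → C∞M) (d : Fin n → Derivation ℝ C∞M C∞M),
      χ m₀ = 1 ∧ ∀ (D : Derivation ℝ C∞M C∞M) (f : C∞M), χ * D f = ∑ i, D (x i) * d i f := by
  let b := Module.finBasis ℝ E
  obtain ⟨χ₁, -⟩ := exists_bump_of_mem_nhds (E := E) (Filter.univ_mem (f := nhds m₀))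
  -- Near every point of the support of `χ₂` the function `χ₁` is identically 1, so there the
  -- cut-off coordinates are true coordinates.
  obtain ⟨χ₂, hχ₂⟩ := exists_bump_of_mem_nhds (E := E)
    (eventually_eventually_nhds.2 χ₁.eventuallyEq_one)
  let χ : C∞M := ⟨χ₂, χ₂.contMDiff⟩
  refine ⟨_, χ, fun i => chartFun χ₁ (b.coord i)
    (LinearMap.toContinuousLinearMap (b.coord i)).contDiff.contDiffOn,
    fun i => χ • chartDeriv χ₁ (b i), χ₂.eq_one, fun D f => ?_⟩
  ext m
  rw [contMDiffMap_sum_apply]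
  change χ m * D f m = ∑ i, D _ m * (χ m * chartDeriv χ₁ (b i) f m)
  by_cases hm : m ∈ tsupport χ₂
  · have hm1 : ∀ᶠ m' in nhds m, χ₁ m' = 1 := hχ₂ hm
    obtain ⟨h, hh, hf⟩ := exists_hadamard_chart χ₁ b f hm1
    set x : Fin (Module.finrank ℝ E) → C∞M := fun i => chartFun χ₁ (b.coord i)
      (LinearMap.toContinuousLinearMap (b.coord i)).contDiff.contDiffOn with hx
    -- The Hadamard functions `h` depend on `m`, but only `h i m`, a partial derivative of `f`,
    -- survives: `D` kills constants, and the factors `x i - x i m` vanish at `m`.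
    have hloc : D f m = D (algebraMap ℝ C∞M (f m) +
        ∑ i, (x i - algebraMap ℝ C∞M (b.coord i (extChartAt 𝓘(ℝ, E) m₀ m))) * h i) m := by
      apply derivation_apply_congr
      filter_upwards [hf, hm1] with m' h1 h2
      rw [h1]
      change _ = f m + (∑ i, (x i - algebraMap ℝ C∞M _) * h i) m'
      rw [contMDiffMap_sum_apply]
      congr 1
      refine Finset.sum_congr rfl fun i _ => ?_
      change _ = (χ₁ m' * _ - _) * _
      rw [h2, one_mul]
      rfl
    rw [hloc]
    simp only [map_add, Derivation.map_algebraMap, zero_add, map_sum, Derivation.leibniz, map_sub,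
      sub_zero]
    rw [contMDiffMap_sum_apply, Finset.mul_sum]
    refine Finset.sum_congr rfl fun i _ => ?_
    change χ m * ((χ₁ m * _ - _) * D (h i) m + h i m * D (x i) m) = _
    rw [hm1.self_of_nhds, one_mul, hh]
    have : ∀ c : ℝ, c - algebraMap ℝ C∞M c m = 0 := fun c => sub_self c
    rw [this]
    ring
  · have : χ m = 0 := image_eq_zero_of_notMem_tsupport hm
    simp [this]

end Coordinates

/-! ### The algebraic hypotheses for smooth functions and sections. -/

section Manifold

set_option linter.unusedSectionVars false

open Bundle

variable {E : Type*} [NormedAddCommGroup E] [NormedSpace ℝ E] [FiniteDimensional ℝ E]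
  {M : Type*} [TopologicalSpace M] [ChartedSpace E M] [IsManifold 𝓘(ℝ, E) ∞ M] [T2Space M]

/-- The ordinary derivation underlying a twisted derivation. -/
def TwistedDer.toDerivation {R : Type*} [CommRing R] [Algebra ℝ R] {σ : R ≃ₐ[ℝ] R}
    (D : TwistedDer σ) : Derivation ℝ R R :=
  Derivation.mk' (D.toLinearMap ∘ₗ σ.symm.toLinearMap) fun f g => by
    simp [mul]
    ring

/-- The twisted derivation `d ∘ φ^*` attached to an ordinary derivation `d`. -/
def TwistedDer.ofDerivation {R : Type*} [CommRing R] [Algebra ℝ R] (σ : R ≃ₐ[ℝ] R)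
    (d : Derivation ℝ R R) : TwistedDer σ where
  toLinearMap := d.toLinearMap ∘ₗ σ.toLinearMap
  leibniz' f g := by
    simp
    ring

theorem TwistedDer.ofDerivation_act {R : Type*} [CommRing R] [Algebra ℝ R] (σ : R ≃ₐ[ℝ] R)
    (d : Derivation ℝ R R) (f : R) : (ofDerivation σ d).act f = d f :=
  congrArg d (σ.apply_symm_apply f)

theorem TwistedDer.sum_act {R : Type*} [CommRing R] [Algebra ℝ R] {σ : R ≃ₐ[ℝ] R}
    {ι : Type*} (s : Finset ι) (D : ι → TwistedDer σ) (f : R) :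
    (∑ i ∈ s, D i).act f = ∑ i ∈ s, (D i).act f :=
  map_sum (exactForm f) D s

/-- Dualizing `χ D = ∑ D(x i) d i` gives `χ θ = ∑ θ(d i) d(x i)` with `χ m₀ = 1`, so `χ a = 0`
yields `a m₀ = 0`. -/
theorem locallyExact (σ : C^∞⟮𝓘(ℝ, E), M; 𝓘(ℝ, ℝ), ℝ⟯ ≃ₐ[ℝ] C^∞⟮𝓘(ℝ, E), M; 𝓘(ℝ, ℝ), ℝ⟯) :
    LocallyExact σ := by
  intro θ a h
  ext m₀
  obtain ⟨n, χ, x, d, hχ, hd⟩ := exists_coordinates (E := E) m₀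
  have hD : ∀ D : TwistedDer σ, χ • D = ∑ i, D.act (x i) • TwistedDer.ofDerivation σ (d i) := by
    intro D
    apply TwistedDer.ext_act
    intro f
    rw [TwistedDer.sum_act]
    simp only [TwistedDer.smul_act, TwistedDer.ofDerivation_act]
    exact hd D.toDerivation f
  have hθ : χ • θ = ∑ i, θ (TwistedDer.ofDerivation σ (d i)) • TwistedDer.exactForm (x i) := by
    ext1 D
    have := congrArg θ (hD D)
    rw [map_smul, map_sum] at this
    rw [LinearMap.smul_apply, this, LinearMap.sum_apply]
    refine Finset.sum_congr rfl fun i _ => ?_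
    rw [map_smul, LinearMap.smul_apply, TwistedDer.exactForm_apply, smul_eq_mul, smul_eq_mul,
      mul_comm]
  have h0 := h χ (by
    rw [hθ]
    exact Submodule.sum_mem _ fun i _ => Submodule.smul_mem _ _ (Submodule.subset_span ⟨_, rfl⟩))
  have h1 : χ m₀ * a m₀ = 0 := congrArg (fun u : C^∞⟮𝓘(ℝ, E), M; 𝓘(ℝ, ℝ), ℝ⟯ => u m₀) h0
  rwa [hχ, one_mul] at h1

instance isReduced_smooth : IsReduced C^∞⟮𝓘(ℝ, E), M; 𝓘(ℝ, ℝ), ℝ⟯ where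
  eq_zero f hf := by
    ext m
    have := hf.map (ContMDiffMap.evalRingHom (I := 𝓘(ℝ, E)) (I' := 𝓘(ℝ, ℝ)) (R := ℝ) (n := ∞) m)
    exact this.eq_zero

variable {F : Type*} [NormedAddCommGroup F] [NormedSpace ℝ F] [FiniteDimensional ℝ F]
  {A : M → Type*} [TopologicalSpace (TotalSpace F A)]
  [∀ m, AddCommGroup (A m)] [∀ m, Module ℝ (A m)] [∀ m, TopologicalSpace (A m)]
  [FiberBundle F A] [VectorBundle ℝ F A] [ContMDiffVectorBundle ∞ F A 𝓘(ℝ, E)]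

theorem exists_section_apply_eq {m : M} (v : A m) : ∃ s : Cₛ^∞⟮𝓘(ℝ, E); F, A⟯, s m = v := by
  obtain ⟨u, hu, hs⟩ := FiberBundle.exists_contMDiffOn_extend (k := ∞) 𝓘(ℝ, E) F v
  obtain ⟨χ, hχ⟩ := exists_bump_of_mem_nhds (E := E) (interior_mem_nhds.2 hu)
  refine ⟨⟨fun m' => (χ : M → ℝ) m' • FiberBundle.extend F v m',
    ContMDiffOn.smul_section_of_tsupport χ.contMDiff.contMDiffOn isOpen_interior hχ
      (hs.mono interior_subset)⟩, ?_⟩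
  change (χ : M → ℝ) m • FiberBundle.extend F v m = v
  rw [χ.eq_one, one_smul, FiberBundle.extend_apply_self]

theorem finrank_fiber (m : M) : Module.finrank ℝ (A m) = Module.finrank ℝ F :=
  ((trivializationAt F A m).continuousLinearEquivAt ℝ m
    (FiberBundle.mem_baseSet_trivializationAt F A m)).toLinearEquiv.finrank_eq

/-- If `e ξ` is nonzero at `m`, the relation makes every `η y m` a multiple of `ξ y m`, so the fibre
at `m` has dimension at most 1. Excluding 1 leaves rank 0, where there are no nonzero sections and
`ξ = 0`. In rank 1 all wedges vanish and the claim would fail. -/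
theorem wedgeFaithful (hrank : Module.finrank ℝ F ≠ 1) :
    WedgeFaithful C^∞⟮𝓘(ℝ, E), M; 𝓘(ℝ, ℝ), ℝ⟯ Cₛ^∞⟮𝓘(ℝ, E); F, A⟯ := by
  intro e he
  ext ξ m
  by_contra hne
  change e ξ m ≠ 0 at hne
  have hval : ∀ (y : Cₛ^∞⟮𝓘(ℝ, E); F, A⟯) η, e ξ m * η y m = e η m * ξ y m := fun y η =>
    congrArg (fun u : C^∞⟮𝓘(ℝ, E), M; 𝓘(ℝ, ℝ), ℝ⟯ => u m) (he y ξ η)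
  have hzero : ∀ y y' : Cₛ^∞⟮𝓘(ℝ, E); F, A⟯, ξ y m = ξ y' m → y m = y' m := by
    intro y y' h
    apply eq_of_dual_apply_eq (I := 𝓘(ℝ, E)) (F := F)
    intro η
    apply mul_left_cancel₀ hne
    rw [hval, hval, h]
  have hle : Module.finrank ℝ (A m) ≤ 1 := by
    by_cases h : ∀ y, ξ y m = 0
    · refine finrank_le_one 0 fun w => ⟨0, ?_⟩
      obtain ⟨y, rfl⟩ := exists_section_apply_eq (E := E) (F := F) w
      rw [smul_zero]
      exact (hzero y 0 (by rw [h, h])).symm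
    · push Not at h
      obtain ⟨y₀, h₀⟩ := h
      refine finrank_le_one (y₀ m) fun w => ?_
      obtain ⟨y, rfl⟩ := exists_section_apply_eq (E := E) (F := F) w
      refine ⟨ξ y m / ξ y₀ m, hzero (algebraMap ℝ C^∞⟮𝓘(ℝ, E), M; 𝓘(ℝ, ℝ), ℝ⟯
        (ξ y m / ξ y₀ m) • y₀) y ?_⟩
      rw [map_smul]
      exact div_mul_cancel₀ _ h₀
  have hF : Module.finrank ℝ F = 0 := by
    rw [finrank_fiber (F := F)] at hle
    omega
  have hsub : Subsingleton F := Module.finrank_zero_iff.1 hF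
  have hA : ∀ m' : M, Subsingleton (A m') := fun m' =>
    ((trivializationAt F A m').continuousLinearEquivAt ℝ m'
      (FiberBundle.mem_baseSet_trivializationAt F A m')).toEquiv.subsingleton
  have hξ : ξ = 0 := by
    ext1 y
    have : y = 0 := by
      ext m'
      exact Subsingleton.elim _ _
    rw [this, map_zero, map_zero]
  apply hne
  rw [hξ, map_zero]
  rfl

end Manifold

end HomLie

end

theorem mainTheorem2
    {E : Type*} [NormedAddCommGroup E] [NormedSpace ℝ E] [FiniteDimensional ℝ E]
    {M : Type*} [TopologicalSpace M] [ChartedSpace E M] [IsManifold 𝓘(ℝ, E) ∞ M]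
    [T2Space M] [SigmaCompactSpace M]
    {F : Type*} [NormedAddCommGroup F] [NormedSpace ℝ F] [FiniteDimensional ℝ F]
    {A : M → Type*} [TopologicalSpace (Bundle.TotalSpace F A)]
    [∀ m, AddCommGroup (A m)] [∀ m, Module ℝ (A m)] [∀ m, TopologicalSpace (A m)]
    [FiberBundle F A] [VectorBundle ℝ F A] [ContMDiffVectorBundle ∞ F A 𝓘(ℝ, E)]
    (hrank : Module.finrank ℝ F ≠ 1)
    (φ : M ≃ₘ⟮𝓘(ℝ, E), 𝓘(ℝ, E)⟯ M)
    (HA : HomLie.HomLieAlgebroid (HomLie.pullback φ) Cₛ^∞⟮𝓘(ℝ, E); F, A⟯)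
    (HA' : HomLie.HomLieAlgebroid (HomLie.pullback φ)
      (Module.Dual C^∞⟮𝓘(ℝ, E), M; 𝓘(ℝ, ℝ), ℝ⟯ Cₛ^∞⟮𝓘(ℝ, E); F, A⟯))
    (hA : HomLie.IsHomLieBialgebroid HA HA') :
    HomLie.DefinesHomPoisson (HomLie.piSharp HA HA') ∧
      HomLie.DefinesHomPoisson (HomLie.piBarSharp HA HA') ∧
      HomLie.piSharp HA HA' = - HomLie.piBarSharp HA HA' := by
  have hw := HomLie.wedgeFaithful (E := E) (A := A) hrank
  have hσ := HomLie.locallyExact (HomLie.pullback φ)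
  have hπ := hA.definesHomPoisson_piSharp hw hσ
  have heq := hA.piSharp_eq_neg hw
  refine ⟨hπ, ?_, heq⟩
  have := hπ.neg
  rwa [heq, neg_neg] at this
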